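/- Let $f\colon X\to B$ be a (Hurewicz) fibration, let $j\colon F\to X$ be a homeomorphism of $F$ onto the fibre $f^{-1}(f(j(e_0)))$ for a point $e_0\in F$, and suppose that $F$ and $B$ are connected CW-complexes and that $B$ has finite dimension $d$. Let $\phi\colon\pi_1(X,j(e_0))\to G$ be an epimorphism of groups and let $p\colon\overline X\to X$ be the $G$-covering associated to $\phi$. Let $G_1(F)\subseteq\pi_1(F,e_0)$ be Gottlieb's subgroup, i.e. the subgroup of those classes that are represented by the loop $t\mapsto h(e_0,t)$ for some homotopy $h\colon F\times[0,1]\to F$ with $h(x,0)=h(x,1)=x$ for all $x\in F$. Let $A\subseteq G$ be the image of $G_1(F)$ under $\phi\circ\pi_1(j)\colon\pi_1(F,e_0)\to G$. Then $A$ is a normal abelian subgroup of $G$, and for every $n\ge 0$ the induced $A$-action on $\overline X$ turns the singular homology $H_n(\overline X)=H_n(\overline X;\mathbb Z)$ into a nilpotent $\mathbb ZA$-module of filtration length $\le d+1$. Here a $\mathbb ZA$-module $M$ is called nilpotent if for some $r\ge 0$ there is a filtration $0=M_0\subseteq M_1\subseteq\dots\subseteq M_r=M$ by $\mathbb ZA$-submodules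 such that $A$ acts trivially on $M_i/M_{i-1}$ for $i=1,\dots,r$; the least such $r$ is its filtration length. -/

import Mathlib

open Set Topology CategoryTheory
open scoped unitInterval

universe u v

noncomputable section

/-! ### Dimension of a CW-complex -/

/-- The dimension of a CW-complex: the supremum of the dimensions of its cells. -/
def cwDim {B : Type u} [TopologicalSpace B] (C : Set B) [CWComplex C] : ℕ∞ :=
  ⨆ (n : ℕ) (_ : Nonempty (Topology.RelCWComplex.cell C n)), (n : ℕ∞)

/-! ### Fibrations -/

/-- A (Hurewicz) fibration: a continuous map with the homotopy lifting property with respect to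
all spaces. -/
def IsHurewiczFibration {X B : Type u} [TopologicalSpace X] [TopologicalSpace B]
    (f : C(X, B)) : Prop :=
  ∀ (Y : Type u) [TopologicalSpace Y] (H : C(I × Y, B)) (g : C(Y, X)),
    (∀ y, H (0, y) = f (g y)) →
      ∃ K : C(I × Y, X), (∀ y, K (0, y) = g y) ∧ ∀ z, f (K z) = H z

/-- `F → X → B` is a fibration with fibre inclusion `j`: the map `f` is a fibration and `j` is a
homeomorphism of `F` onto the fibre of `f` over `b`. -/
structure IsFibrationWithFibre {F X B : Type u} [TopologicalSpace F] [TopologicalSpace X]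
    [TopologicalSpace B] (j : C(F, X)) (f : C(X, B)) (b : B) : Prop where
  isFibration : IsHurewiczFibration f
  isEmbedding : IsEmbedding j
  range_eq : range j = f ⁻¹' {b}

/-! ### Gottlieb's subgroup of the fundamental group -/

/-- The loop `t ↦ h (x₀, t)` traced out by the point `x₀` under a homotopy `h : id ≃ id`. -/
def trackLoop {F : Type u} [TopologicalSpace F] (x₀ : F)
    (h : ContinuousMap.Homotopy (ContinuousMap.id F) (ContinuousMap.id F)) : Path x₀ x₀ where
  toFun t := h (t, x₀)
  source' := h.apply_zero x₀
  target' := h.apply_one x₀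

/-- Gottlieb's subgroup `G₁(F, x₀) ⊆ π₁(F, x₀)`: the classes of the loops `t ↦ h (x₀, t)`, for all
homotopies `h` from the identity of `F` to itself. -/
def gottliebSubgroup (F : Type u) [TopologicalSpace F] (x₀ : F) :
    Subgroup (FundamentalGroup F x₀) where
  carrier := {w | ∃ h : ContinuousMap.Homotopy (ContinuousMap.id F) (ContinuousMap.id F),
    FundamentalGroup.fromPath (Path.Homotopic.Quotient.mk (trackLoop x₀ h)) = w}
  one_mem' := ⟨ContinuousMap.Homotopy.refl _, rfl⟩
  mul_mem' := by
    rintro _ _ ⟨h, rfl⟩ ⟨k, rfl⟩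
    refine ⟨k.trans h, ?_⟩
    rw [FundamentalGroup.mul_def]
    refine congrArg Path.Homotopic.Quotient.mk ?_
    ext t
    rw [Path.trans_apply]
    exact ContinuousMap.Homotopy.trans_apply k h (t, x₀)
  inv_mem' := by
    rintro _ ⟨h, rfl⟩
    exact ⟨h.symm, rfl⟩

/-- The image of `G₁(F, e₀)` under `φ ∘ π₁(j) : π₁(F, e₀) → π₁(X, j e₀) → G`. -/
def gottliebImage {F X : Type u} [TopologicalSpace F] [TopologicalSpace X] {G : Type v} [Group G]
    (j : C(F, X)) (e₀ : F) (φ : FundamentalGroup X (j e₀) →* G) : Subgroup G :=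
  (gottliebSubgroup F e₀).map (φ.comp (FundamentalGroup.map j e₀))

/-! ### The `G`-covering associated to a homomorphism `π₁(X) → G` -/

/-- `p : E → X` is the `G`-covering associated to `φ : π₁(X, x₀) → G`: it is a covering whose
fibres are the orbits of a free (properly discontinuous) `G`-action on `E`, and for a suitable base
point `e` over `x₀` its monodromy is given by `φ`. In Mathlib `γ * γ'` in the fundamental group is
the loop `γ'` followed by `γ`; with this multiplication, the element of `G` which
moves `e` to the endpoint of the lift of `γ` starting at `e` depends anti-multiplicatively
on `γ`, hence the inverse. -/
def IsAssociatedCovering {X E : Type u} [TopologicalSpace X] [TopologicalSpace E] {G : Type v}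
    [Group G] [MulAction G E] {x₀ : X} (p : E → X) (φ : FundamentalGroup X x₀ →* G) : Prop :=
  ∃ hp : IsQuotientCoveringMap p G, ∃ e : p ⁻¹' {x₀}, ∀ γ : FundamentalGroup X x₀,
    (hp.isCoveringMap.monodromy γ.toPath e : E) = (φ γ)⁻¹ • (e : E)

/-! ### Singular homology with a group action -/

/-- The singular homology functor `H_n(-; ℤ)`. -/
def singularHomologyZ (n : ℕ) : TopCat.{u} ⥤ ModuleCat.{u} ℤ :=
  (AlgebraicTopology.singularHomologyFunctor (ModuleCat.{u} ℤ) n).obj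
    (ModuleCat.of ℤ (ULift.{u} ℤ))

/-- The self-map `x ↦ a • x` of a space with an action by homeomorphisms. -/
def smulHom (G : Type v) [Group G] (E : Type u) [TopologicalSpace E] [MulAction G E]
    [ContinuousConstSMul G E] (a : G) : TopCat.of E ⟶ TopCat.of E :=
  TopCat.ofHom ⟨fun x => a • x, continuous_const_smul a⟩

/-- The `ℤG`-module `H_n(E)` of a space `E` with an action of `G` by homeomorphisms. -/
def homologyRep (G : Type v) [Group G] (E : Type u) [TopologicalSpace E] [MulAction G E]
    [ContinuousConstSMul G E] (n : ℕ) :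
    Representation ℤ G ((singularHomologyZ.{u} n).obj (TopCat.of E)) where
  toFun a := ((singularHomologyZ n).map (smulHom G E a)).hom
  map_one' := by
    have h : smulHom G E 1 = 𝟙 (TopCat.of E) := by
      ext x
      exact one_smul G x
    rw [h, CategoryTheory.Functor.map_id]
    rfl
  map_mul' a b := by
    have h : smulHom G E (a * b) = smulHom G E b ≫ smulHom G E a := by
      ext x
      exact mul_smul a b x
    rw [h, CategoryTheory.Functor.map_comp]
    rfl

/-- The `ℤA`-module `H_n(E)` for a subgroup `A` of a group `G` acting on `E`. -/
def subgroupHomologyRep {G : Type v} [Group G] (A : Subgroup G) (E : Type u) [TopologicalSpace E]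
    [MulAction G E] [ContinuousConstSMul G E] (n : ℕ) :
    Representation ℤ A ((singularHomologyZ.{u} n).obj (TopCat.of E)) :=
  (homologyRep G E n).comp A.subtype

/-! ### Nilpotent modules -/

section Nilpotent

variable {A : Type v} [Group A] {M : Type u} [AddCommGroup M] [Module ℤ M]
  (ρ : Representation ℤ A M)

/-- The `ℤA`-module `M` has a filtration `0 = M₀ ⊆ M₁ ⊆ ⋯ ⊆ M_r = M` by `ℤA`-submodules such
that `A` acts trivially on each `M_{i+1} / M_i`. -/
def HasNilpotentFiltration (r : ℕ) : Prop :=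
  ∃ N : ℕ → Submodule ℤ M,
    N 0 = ⊥ ∧ N r = ⊤ ∧
    (∀ i ≤ r, ∀ a : A, ∀ m ∈ N i, ρ a m ∈ N i) ∧
    (∀ i < r, N i ≤ N (i + 1)) ∧
    (∀ i < r, ∀ a : A, ∀ m ∈ N (i + 1), ρ a m - m ∈ N i)

/-- A nilpotent `ℤA`-module. -/
def IsNilpotentModule : Prop := ∃ r : ℕ, HasNilpotentFiltration ρ r

/-- The filtration length of a nilpotent `ℤA`-module. -/
def filtrationLength : ℕ := sInf {r : ℕ | HasNilpotentFiltration ρ r}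

end Nilpotent

end

noncomputable section

/-! ### Chains of ordered tuples -/

/-! Write b₀ = f(j(e₀)) and q = f ∘ p. The group A is first recognised upstairs. An element a is a
fibre motion at a point x over b₀ if some homotopy from the identity of f⁻¹(b₀) to itself, inside
this fibre, has a track through p(x) that lifts to a path from x to a • x. By
`mem_gottliebImage_iff`, A consists of the fibre motions at the base point e. The notion does not
depend on the point over b₀. A path in E between two such points projects to a loop in B, and
lifting along this loop and back carries a motion at one point to a motion at the other
(`IsFibreMotion.transport`); E is path connected because φ is onto. Translation by g turns the
motion a at e into the motion g a g⁻¹ at g • e, so A is normal. Unique path lifting shows that two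
motions at e commute on e, and freeness of the action makes A abelian.

For the homology, every a in A acts on q⁻¹(b₀) by a map homotopic to the identity inside q⁻¹(b₀)
(`exists_fibre_homotopy_smul`). Path lifting spreads this homotopy over any part of B that contracts
in B to b₀, such as the union of the open k-cells, and the resulting homotopy moves points only
within the fibres of q (`exists_homotopy_smul_of_paths`). Cover the part of E over the cells of
dimension at most k by the part over the open k-cells and the part over a neighbourhood that deforms
into the lower skeleton. After subdivision a cycle is z = x + y accordingly. The homotopy replaces a
y - y by the prism over ∂y = -∂x, which lies over the neighbourhood; so a z - z is homologous to a
cycle there (`SingChain.kill_succ_of_cover`), and then to one over the lower skeleton. One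
difference is spent per dimension, so d + 1 differences annihilate the homology
(`kill_over_cwSkel`), and the upper filtration has length at most d + 1.

This argument needs control of supports, so it runs on explicit augmented singular chains graded by
the number of vertices. The chain homotopies for subdivision and for prisms both come from one
recursive coning on tuples of points, `TupleChain.coneHomotopy`. The result is then carried over to
singular homology. -/

/-- The free abelian group on the `n`-tuples of elements of `Q`. -/
abbrev TupleChain (Q : Type*) (n : ℕ) : Type _ := (Fin n → Q) →₀ ℤ

namespace TupleChain

variable {Q Q' Q'' : Type*}

/-- The alternating sum of the faces of a tuple; the empty tuple is allowed as a face. -/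
def d (Q : Type*) (n : ℕ) : TupleChain Q (n + 1) →ₗ[ℤ] TupleChain Q n :=
  ∑ i : Fin (n + 1), (-1 : ℤ) ^ (i : ℕ) • Finsupp.lmapDomain ℤ ℤ (fun v => v ∘ i.succAbove)

/-- The map induced on tuple chains by a map of sets. -/
def map (f : Q → Q') (n : ℕ) : TupleChain Q n →ₗ[ℤ] TupleChain Q' n :=
  Finsupp.lmapDomain ℤ ℤ (fun v => f ∘ v)

/-- The cone with apex `b`. -/
def cone (b : Q) (n : ℕ) : TupleChain Q n →ₗ[ℤ] TupleChain Q (n + 1) :=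
  Finsupp.lmapDomain ℤ ℤ (fun v => (Fin.cons b v : Fin (n + 1) → Q))

@[simp] lemma map_single (f : Q → Q') (n : ℕ) (v : Fin n → Q) (k : ℤ) :
    map f n (.single v k) = .single (f ∘ v) k := by
  simp [map, Finsupp.mapDomain_single]

@[simp] lemma cone_single (b : Q) (n : ℕ) (v : Fin n → Q) (k : ℤ) :
    cone b n (.single v k) = .single (Fin.cons b v : Fin (n + 1) → Q) k := by
  simp [cone, Finsupp.mapDomain_single]

lemma d_single (n : ℕ) (v : Fin (n + 1) → Q) :
    d Q n (.single v 1) = ∑ i : Fin (n + 1), (-1 : ℤ) ^ (i : ℕ) • .single (v ∘ i.succAbove) 1 := by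
  simp only [d, LinearMap.sum_apply, LinearMap.smul_apply, Finsupp.lmapDomain_apply,
    Finsupp.mapDomain_single]

lemma map_map (f : Q → Q') (g : Q' → Q'') (n : ℕ) (c : TupleChain Q n) :
    map g n (map f n c) = map (g ∘ f) n c := by
  induction c using Finsupp.induction_linear with
  | zero => simp
  | add x y hx hy => simp [hx, hy]
  | single v k => simp [Function.comp_assoc]

lemma d_map (f : Q → Q') (n : ℕ) (c : TupleChain Q (n + 1)) :
    d Q' n (map f (n + 1) c) = map f n (d Q n c) := by
  suffices d Q' n ∘ₗ map f (n + 1) = map f n ∘ₗ d Q n from DFunLike.congr_fun this c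
  ext v : 2
  simp only [LinearMap.comp_apply, Finsupp.lsingle_apply, map_single, d_single, map_sum, map_smul]
  rfl

lemma d_cone_zero (b : Q) (c : TupleChain Q 0) : d Q 0 (cone b 0 c) = c := by
  suffices d Q 0 ∘ₗ cone b 0 = LinearMap.id from DFunLike.congr_fun this c
  ext v : 2
  simp only [LinearMap.comp_apply, Finsupp.lsingle_apply, cone_single, d_single, LinearMap.id_apply]
  simp [Subsingleton.elim _ v]

/-- Omitting the apex returns the base; the other faces are cones over the faces of the base, with
the sign shifted by one position. -/
lemma d_cone (b : Q) (n : ℕ) (c : TupleChain Q (n + 1)) :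
    d Q (n + 1) (cone b (n + 1) c) = c - cone b n (d Q n c) := by
  suffices d Q (n + 1) ∘ₗ cone b (n + 1) = LinearMap.id - cone b n ∘ₗ d Q n from
    DFunLike.congr_fun this c
  ext v : 2
  simp only [LinearMap.comp_apply, Finsupp.lsingle_apply, cone_single, d_single,
    LinearMap.sub_apply, LinearMap.id_apply, map_sum, map_smul]
  rw [Fin.sum_univ_succ, sub_eq_add_neg, ← Finset.sum_neg_distrib]
  congr 1
  · simp only [Fin.val_zero, pow_zero, one_smul]
    congr 1
  · refine Finset.sum_congr rfl fun i _ => ?_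
    rw [← neg_smul, Fin.val_succ, pow_succ, mul_neg_one]
    congr 2
    funext j
    refine Fin.cases ?_ (fun k => ?_) j <;> simp

/-- Every nonempty tuple is the cone over its tail with its first entry as apex, so the cone formula
reduces the claim to one degree lower. -/
lemma d_d (n : ℕ) (c : TupleChain Q (n + 2)) : d Q n (d Q (n + 1) c) = 0 := by
  induction n with
  | zero =>
    induction c using Finsupp.induction_linear with
    | zero => simp
    | add x y hx hy => simp [hx, hy]
    | single v k =>
      rw [← Fin.cons_self_tail v, ← cone_single, d_cone, map_sub, d_cone_zero, sub_self]
  | succ n ih =>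
    induction c using Finsupp.induction_linear with
    | zero => simp
    | add x y hx hy => simp [hx, hy]
    | single v k =>
      rw [← Fin.cons_self_tail v, ← cone_single, d_cone, map_sub, d_cone, ih, map_zero, sub_zero,
        sub_self]

/-- Apply `F` to each tuple and take the cone whose apex depends on the tuple. -/
def coneLin {n m : ℕ} (b : (Fin n → Q) → Q') (F : TupleChain Q n →ₗ[ℤ] TupleChain Q' m) :
    TupleChain Q n →ₗ[ℤ] TupleChain Q' (m + 1) :=
  Finsupp.linearCombination ℤ fun v => cone (b v) m (F (.single v 1))

lemma coneLin_single {n m : ℕ} (b : (Fin n → Q) → Q') (F : TupleChain Q n →ₗ[ℤ] TupleChain Q' m)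
    (v : Fin n → Q) : coneLin b F (.single v 1) = cone (b v) m (F (.single v 1)) := by
  simp [coneLin]

lemma d_coneLin_zero {n : ℕ} (b : (Fin n → Q) → Q') (F : TupleChain Q n →ₗ[ℤ] TupleChain Q' 0) :
    d Q' 0 ∘ₗ coneLin b F = F := by
  ext v : 2
  simp only [LinearMap.comp_apply, Finsupp.lsingle_apply, coneLin_single, d_cone_zero]

lemma d_coneLin {n m : ℕ} (b : (Fin n → Q) → Q') (F : TupleChain Q n →ₗ[ℤ] TupleChain Q' (m + 1))
    (hF : d Q' m ∘ₗ F = 0) : d Q' (m + 1) ∘ₗ coneLin b F = F := by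
  ext v : 2
  have := DFunLike.congr_fun hF (.single v 1)
  simp only [LinearMap.comp_apply, LinearMap.zero_apply] at this
  simp only [LinearMap.comp_apply, Finsupp.lsingle_apply, coneLin_single, d_cone, this, map_zero,
    sub_zero]

lemma map_cone (f : Q → Q') (b : Q) (n : ℕ) (c : TupleChain Q n) :
    map f (n + 1) (cone b n c) = cone (f b) n (map f n c) := by
  suffices map f (n + 1) ∘ₗ cone b n = cone (f b) n ∘ₗ map f n from DFunLike.congr_fun this c
  ext v : 2
  simp only [LinearMap.comp_apply, Finsupp.lsingle_apply, map_single, cone_single]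
  congr 1
  funext j
  refine Fin.cases ?_ (fun k => ?_) j <;> simp

/-- The chain homotopy between two chain maps obtained by coning off recursively. -/
def coneHomotopy (b : ∀ n, (Fin (n + 1) → Q) → Q')
    (f g : ∀ n, TupleChain Q n →ₗ[ℤ] TupleChain Q' n) :
    ∀ n, TupleChain Q n →ₗ[ℤ] TupleChain Q' (n + 1)
  | 0 => 0
  | n + 1 => coneLin (b n) (f (n + 1) - g (n + 1) - coneHomotopy b f g n ∘ₗ d Q n)

/-- By induction f - g - H d is annihilated by d, and the cone over a cycle has that cycle as its
boundary. The assumption f = g on the empty tuple starts the recursion. -/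
lemma coneHomotopy_spec (b : ∀ n, (Fin (n + 1) → Q) → Q')
    (f g : ∀ n, TupleChain Q n →ₗ[ℤ] TupleChain Q' n) (h0 : f 0 = g 0)
    (hf : ∀ n, d Q' n ∘ₗ f (n + 1) = f n ∘ₗ d Q n) (hg : ∀ n, d Q' n ∘ₗ g (n + 1) = g n ∘ₗ d Q n)
    (n : ℕ) : d Q' (n + 1) ∘ₗ coneHomotopy b f g (n + 1) =
      f (n + 1) - g (n + 1) - coneHomotopy b f g n ∘ₗ d Q n := by
  have hdd : ∀ n, d Q n ∘ₗ d Q (n + 1) = 0 := fun n => LinearMap.ext (d_d n)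
  induction n with
  | zero =>
    refine d_coneLin _ _ ?_
    rw [LinearMap.comp_sub, LinearMap.comp_sub, hf, hg, h0]
    simp [coneHomotopy]
  | succ n ih =>
    refine d_coneLin _ _ ?_
    rw [LinearMap.comp_sub, LinearMap.comp_sub, hf, hg, ← LinearMap.comp_assoc, ih,
      LinearMap.sub_comp, LinearMap.sub_comp, LinearMap.comp_assoc, hdd]
    simp

/-- Coning is natural, so naturality of the rule choosing the apex passes to the whole homotopy.
This is what lets constructions on tuples descend to singular simplices. -/
lemma coneHomotopy_natural {R R' : Type*} (φ : Q → R) (φ' : Q' → R')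
    (b : ∀ n, (Fin (n + 1) → Q) → Q') (b' : ∀ n, (Fin (n + 1) → R) → R')
    (f g : ∀ n, TupleChain Q n →ₗ[ℤ] TupleChain Q' n)
    (f' g' : ∀ n, TupleChain R n →ₗ[ℤ] TupleChain R' n)
    (hb : ∀ n v, φ' (b n v) = b' n (φ ∘ v))
    (hf : ∀ n c, map φ' n (f n c) = f' n (map φ n c))
    (hg : ∀ n c, map φ' n (g n c) = g' n (map φ n c)) (n : ℕ) (c : TupleChain Q n) :
    map φ' (n + 1) (coneHomotopy b f g n c) = coneHomotopy b' f' g' n (map φ n c) := by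
  induction n with
  | zero => simp [coneHomotopy]
  | succ n ih =>
    suffices map φ' (n + 2) ∘ₗ coneHomotopy b f g (n + 1) =
      coneHomotopy b' f' g' (n + 1) ∘ₗ map φ (n + 1) from DFunLike.congr_fun this c
    ext v : 2
    simp only [LinearMap.comp_apply, Finsupp.lsingle_apply, coneHomotopy, coneLin_single,
      map_single, map_cone, hb, LinearMap.sub_apply, map_sub, hf, hg, ih, ← d_map]

end TupleChain

/-! ### Affine simplices in convex sets -/

section Affine

variable {W W' : Type*} [NormedAddCommGroup W] [NormedSpace ℝ W]
  [NormedAddCommGroup W'] [NormedSpace ℝ W']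

/-- The affine simplex spanned by a tuple of points of a convex set. -/
def affSimplex {Q : Set W} (hQ : Convex ℝ Q) {n : ℕ} (v : Fin n → Q) :
    C(stdSimplex ℝ (Fin n), Q) where
  toFun t := ⟨∑ i, t i • (v i : W), hQ.sum_mem (fun i _ => t.2.1 i) t.2.2 fun i _ => (v i).2⟩
  continuous_toFun := by
    refine Continuous.subtype_mk (continuous_finsetSum _ fun i _ => ?_) _
    exact ((continuous_apply i).comp continuous_subtype_val).smul continuous_const

lemma affSimplex_coe {Q : Set W} (hQ : Convex ℝ Q) {n : ℕ} (v : Fin n → Q)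
    (t : stdSimplex ℝ (Fin n)) : (affSimplex hQ v t : W) = ∑ i, t i • (v i : W) := rfl

/-- A map between convex sets which preserves convex combinations. -/
def IsAffineMap {Q : Set W} (hQ : Convex ℝ Q) {Q' : Set W'} (hQ' : Convex ℝ Q') (f : Q → Q') :
    Prop :=
  ∀ (n : ℕ) (v : Fin n → Q) (t : stdSimplex ℝ (Fin n)),
    f (affSimplex hQ v t) = affSimplex hQ' (f ∘ v) t

lemma isAffineMap_affSimplex {Q : Set W} (hQ : Convex ℝ Q) {n : ℕ} (v : Fin n → Q) :
    IsAffineMap (convex_stdSimplex ℝ (Fin n)) hQ (affSimplex hQ v) := by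
  intro m w t
  apply Subtype.ext
  have h : ∀ i, (affSimplex (convex_stdSimplex ℝ (Fin n)) w t) i = ∑ j, t j * w j i := by
    intro i
    change (affSimplex (convex_stdSimplex ℝ (Fin n)) w t).1 i = _
    rw [affSimplex_coe, Finset.sum_apply]
    rfl
  simp only [affSimplex_coe, h, Function.comp_apply, Finset.sum_smul, Finset.smul_sum, mul_smul]
  exact Finset.sum_comm

/-- The `i`-th face inclusion of standard simplices. -/
def faceIncl (n : ℕ) (i : Fin (n + 1)) : C(stdSimplex ℝ (Fin n), stdSimplex ℝ (Fin (n + 1))) :=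
  ⟨_, stdSimplex.continuous_map i.succAbove⟩

/-- The tuple of vertices of the standard simplex. -/
def stdVertices (n : ℕ) : Fin n → stdSimplex ℝ (Fin n) := fun i => stdSimplex.vertex i

lemma affSimplex_stdVertices {Q : Set W} (hQ : Convex ℝ Q) {n : ℕ} (v : Fin n → Q) :
    affSimplex hQ v ∘ stdVertices n = v := by
  funext i
  apply Subtype.ext
  rw [Function.comp_apply, affSimplex_coe, Finset.sum_eq_single i]
  · simp [stdVertices]
  · intro j _ hj
    simp [stdVertices, hj]
  · simp

lemma affSimplex_self (n : ℕ) :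
    affSimplex (convex_stdSimplex ℝ (Fin n)) (stdVertices n) = ContinuousMap.id _ := by
  ext t : 1
  apply Subtype.ext
  funext j
  rw [affSimplex_coe, Finset.sum_apply, Finset.sum_eq_single j]
  · simp only [stdVertices, Pi.smul_apply, Pi.single_eq_same, smul_eq_mul,
      mul_one, ContinuousMap.id_apply]
    rfl
  · intro i _ hi
    simp [stdVertices, hi.symm]
  · simp

lemma faceIncl_eq_affSimplex (n : ℕ) (i : Fin (n + 1)) :
    faceIncl n i = affSimplex (convex_stdSimplex ℝ (Fin (n + 1))) (stdVertices (n + 1) ∘ i.succAbove) := by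
  ext t : 1
  apply Subtype.ext
  funext j
  change stdSimplex.map i.succAbove t j = _
  rw [stdSimplex.map_coe, FunOnFinite.linearMap_apply_apply, affSimplex_coe, Finset.sum_apply,
    Finset.sum_filter]
  refine Finset.sum_congr rfl fun k _ => ?_
  simp [stdVertices, Pi.single_apply, eq_comm]

lemma affSimplex_comp_affSimplex {Q : Set W} (hQ : Convex ℝ Q) {n m : ℕ} (v : Fin n → Q)
    (w : Fin m → stdSimplex ℝ (Fin n)) :
    (affSimplex hQ v).comp (affSimplex (convex_stdSimplex ℝ (Fin n)) w) =
      affSimplex hQ (affSimplex hQ v ∘ w) :=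
  ContinuousMap.ext fun t => isAffineMap_affSimplex hQ v m w t

lemma affSimplex_comp_faceIncl {Q : Set W} (hQ : Convex ℝ Q) {n : ℕ} (v : Fin (n + 1) → Q)
    (i : Fin (n + 1)) :
    (affSimplex hQ v).comp (faceIncl n i) = affSimplex hQ (v ∘ i.succAbove) := by
  rw [faceIncl_eq_affSimplex, affSimplex_comp_affSimplex, ← Function.comp_assoc,
    affSimplex_stdVertices]

lemma faceIncl_comp_stdVertices (n : ℕ) (i : Fin (n + 1)) :
    faceIncl n i ∘ stdVertices n = stdVertices (n + 1) ∘ i.succAbove := by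
  rw [faceIncl_eq_affSimplex, affSimplex_stdVertices]

end Affine
end

noncomputable section

/-! ### Barycentric subdivision of affine simplices -/

section Subdivision

variable {W W' : Type*} [NormedAddCommGroup W] [NormedSpace ℝ W]
  [NormedAddCommGroup W'] [NormedSpace ℝ W']

/-- The barycenter of a tuple of points in a convex set. -/
def tupleBary {Q : Set W} (hQ : Convex ℝ Q) (n : ℕ) (v : Fin (n + 1) → Q) : Q :=
  affSimplex hQ v stdSimplex.barycenter

/-- Barycentric subdivision of tuple chains. -/
def tupleSd {Q : Set W} (hQ : Convex ℝ Q) : ∀ n, TupleChain Q n →ₗ[ℤ] TupleChain Q n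
  | 0 => LinearMap.id
  | n + 1 => TupleChain.coneLin (tupleBary hQ n) (tupleSd hQ n ∘ₗ TupleChain.d Q n)

lemma d_comp_tupleSd {Q : Set W} (hQ : Convex ℝ Q) (n : ℕ) :
    TupleChain.d Q n ∘ₗ tupleSd hQ (n + 1) = tupleSd hQ n ∘ₗ TupleChain.d Q n := by
  induction n with
  | zero => exact TupleChain.d_coneLin_zero _ _
  | succ n ih =>
    refine TupleChain.d_coneLin _ _ ?_
    rw [← LinearMap.comp_assoc, ih, LinearMap.comp_assoc,
      show TupleChain.d Q n ∘ₗ TupleChain.d Q (n + 1) = 0 from LinearMap.ext (TupleChain.d_d n),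
      LinearMap.comp_zero]

/-- The chain homotopy between barycentric subdivision and the identity. -/
def tupleSdHomotopy {Q : Set W} (hQ : Convex ℝ Q) :
    ∀ n, TupleChain Q n →ₗ[ℤ] TupleChain Q (n + 1) :=
  TupleChain.coneHomotopy (tupleBary hQ) (fun _ => LinearMap.id) (tupleSd hQ)

lemma map_tupleSd {Q : Set W} (hQ : Convex ℝ Q) {Q' : Set W'} (hQ' : Convex ℝ Q') {f : Q → Q'}
    (hf : IsAffineMap hQ hQ' f) (n : ℕ) (c : TupleChain Q n) :
    TupleChain.map f n (tupleSd hQ n c) = tupleSd hQ' n (TupleChain.map f n c) := by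
  induction n with
  | zero => rfl
  | succ n ih =>
    suffices TupleChain.map f (n + 1) ∘ₗ tupleSd hQ (n + 1) =
      tupleSd hQ' (n + 1) ∘ₗ TupleChain.map f (n + 1) from DFunLike.congr_fun this c
    ext v : 2
    simp only [LinearMap.comp_apply, Finsupp.lsingle_apply, tupleSd, TupleChain.coneLin_single,
      TupleChain.map_single, TupleChain.map_cone, ih, ← TupleChain.d_map]
    rw [tupleBary, hf]
    rfl

lemma map_tupleSdHomotopy {Q : Set W} (hQ : Convex ℝ Q) {Q' : Set W'} (hQ' : Convex ℝ Q')
    {f : Q → Q'} (hf : IsAffineMap hQ hQ' f) (n : ℕ) (c : TupleChain Q n) :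
    TupleChain.map f (n + 1) (tupleSdHomotopy hQ n c) =
      tupleSdHomotopy hQ' n (TupleChain.map f n c) :=
  TupleChain.coneHomotopy_natural f f _ _ _ _ _ _ (fun _ v => hf _ v _) (fun _ _ => rfl)
    (fun n c => map_tupleSd hQ hQ' hf n c) n c

lemma coe_affSimplex_mem_convexHull {Q : Set W} (hQ : Convex ℝ Q) {n : ℕ} (v : Fin n → Q)
    (t : stdSimplex ℝ (Fin n)) :
    (affSimplex hQ v t : W) ∈ convexHull ℝ (range fun i => (v i : W)) := by
  rw [affSimplex_coe]
  exact (convex_convexHull ℝ _).sum_mem (fun i _ => t.2.1 i) t.2.2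
    fun i _ => subset_convexHull ℝ _ ⟨i, rfl⟩

lemma dist_affSimplex_le {Q : Set W} (hQ : Convex ℝ Q) {n : ℕ} (v : Fin n → Q) {r : ℝ}
    (hv : ∀ i j, dist (v i) (v j) ≤ r) (s t : stdSimplex ℝ (Fin n)) :
    dist (affSimplex hQ v s) (affSimplex hQ v t) ≤ r := by
  obtain ⟨_, ⟨i, rfl⟩, _, ⟨j, rfl⟩, h⟩ := convexHull_exists_dist_ge2
    (coe_affSimplex_mem_convexHull hQ v s) (coe_affSimplex_mem_convexHull hQ v t)
  exact h.trans (hv i j)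

/-- A point of the hull is no farther from the barycentre than some vertex `v i`. The vector from
the barycentre to `v i` is the average of the n + 1 differences `v i - v j`, of which the one with j
= i vanishes; this gives the contraction factor n / (n + 1). -/
lemma dist_tupleBary_le {Q : Set W} (hQ : Convex ℝ Q) {n : ℕ} (v : Fin (n + 1) → Q) {r : ℝ}
    (hv : ∀ i j, dist (v i) (v j) ≤ r) {x : W} (hx : x ∈ convexHull ℝ (range fun i => (v i : W))) :
    dist x (tupleBary hQ n v) ≤ n / (n + 1) * r := by
  obtain ⟨_, ⟨i, rfl⟩, h⟩ := convexHull_exists_dist_ge hx (tupleBary hQ n v : W)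
  refine h.trans ?_
  have hn : (n + 1 : ℝ) ≠ 0 := by positivity
  have h1 : (v i : W) - tupleBary hQ n v = ∑ j, (n + 1 : ℝ)⁻¹ • ((v i : W) - v j) := by
    rw [tupleBary, affSimplex_coe, ← Finset.smul_sum, Finset.sum_sub_distrib, smul_sub,
      Finset.smul_sum (s := Finset.univ) (f := fun j => (v j : W))]
    congr 1
    · rw [Finset.sum_const, Finset.card_univ, Fintype.card_fin, ← Nat.cast_smul_eq_nsmul ℝ,
        smul_smul]
      push_cast
      rw [inv_mul_cancel₀ hn, one_smul]
    · refine Finset.sum_congr rfl fun j _ => ?_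
      congr 1
      change ((Fintype.card (Fin (n + 1)) : ℝ))⁻¹ = _
      simp
  rw [dist_eq_norm, h1, Fin.sum_univ_succAbove _ i, sub_self, smul_zero, zero_add]
  refine (norm_sum_le _ _).trans ?_
  calc ∑ j : Fin n, ‖(n + 1 : ℝ)⁻¹ • ((v i : W) - v (i.succAbove j))‖
      ≤ ∑ j : Fin n, (n + 1 : ℝ)⁻¹ * r := by
        refine Finset.sum_le_sum fun j _ => ?_
        rw [norm_smul, Real.norm_of_nonneg (by positivity), ← dist_eq_norm]
        exact mul_le_mul_of_nonneg_left (hv _ _) (by positivity)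
    _ = n / (n + 1) * r := by
        rw [Finset.sum_const, Finset.card_univ, Fintype.card_fin, nsmul_eq_mul]
        ring

/-- The tuples of pairwise distance at most `r` with vertices in the convex set `K`. -/
def smallTuples {Q : Set W} (K : Set W) (r : ℝ) (n : ℕ) : Set (Fin n → Q) :=
  {v | (∀ i, (v i : W) ∈ K) ∧ ∀ i j, dist (v i) (v j) ≤ r}

lemma linearMap_mem_of_supported {α M : Type*} [AddCommGroup M] {s : Set α} (F : (α →₀ ℤ) →ₗ[ℤ] M)
    (N : Submodule ℤ M) (h : ∀ a ∈ s, F (.single a 1) ∈ N) {c : α →₀ ℤ}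
    (hc : c ∈ Finsupp.supported ℤ ℤ s) : F c ∈ N := by
  rw [Finsupp.supported_eq_span_single] at hc
  have : Submodule.span ℤ ((fun i => Finsupp.single i (1 : ℤ)) '' s) ≤ N.comap F := by
    rw [Submodule.span_le]
    rintro _ ⟨a, ha, rfl⟩
    exact h a ha
  exact this hc

lemma tupleSd_mem_small {Q : Set W} (hQ : Convex ℝ Q) (n : ℕ) (v : Fin (n + 1) → Q) {r : ℝ}
    (hv : ∀ i j, dist (v i) (v j) ≤ r) :
    tupleSd hQ (n + 1) (.single v 1) ∈ Finsupp.supported ℤ ℤ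
      (smallTuples (convexHull ℝ (range fun i => (v i : W))) (n / (n + 1) * r) (n + 1)) := by
  have hr : 0 ≤ r := dist_nonneg.trans (hv 0 0)
  have hb : (tupleBary hQ n v : W) ∈ convexHull ℝ (range fun i => (v i : W)) :=
    coe_affSimplex_mem_convexHull hQ v _
  have key : ∀ i : Fin (n + 1), tupleSd hQ n (.single (v ∘ i.succAbove) 1) ∈
      Finsupp.supported ℤ ℤ
      (smallTuples (convexHull ℝ (range fun i => (v i : W))) (n / (n + 1) * r) n : 
        Set (Fin n → Q)) := by
    intro i
    cases n with
    | zero =>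
      refine Finsupp.single_mem_supported ℤ _ ⟨fun j => j.elim0, fun j => j.elim0⟩
    | succ n =>
      refine Finsupp.supported_mono ?_
        (tupleSd_mem_small hQ n (v ∘ i.succAbove) fun j k => hv _ _)
      rintro w ⟨hw, hw'⟩
      refine ⟨fun j => convexHull_mono ?_ (hw j), fun j k => (hw' j k).trans ?_⟩
      · rintro _ ⟨j, rfl⟩
        exact ⟨_, rfl⟩
      -- The factor n / (n + 1) grows with n, so the bound for a face implies the bound demanded for
      -- the whole simplex.
      · refine mul_le_mul_of_nonneg_right ?_ hr
        rw [div_le_div_iff₀ (by positivity) (by positivity)]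
        push_cast
        nlinarith
  rw [tupleSd, TupleChain.coneLin_single, LinearMap.comp_apply, TupleChain.d_single, map_sum,
    map_sum]
  refine Submodule.sum_mem _ fun i _ => ?_
  rw [map_smul, map_smul]
  refine Submodule.smul_mem _ _ (linearMap_mem_of_supported (TupleChain.cone _ _) _ ?_ (key i))
  rintro w ⟨hw, hw'⟩
  rw [TupleChain.cone_single]
  refine Finsupp.single_mem_supported ℤ _ ⟨fun j => ?_, fun j k => ?_⟩
  · refine Fin.cases ?_ (fun j => ?_) j
    · exact hb
    · exact hw j
  · have h0 : (0 : ℝ) ≤ n / (n + 1) * r := by positivity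
    refine Fin.cases ?_ (fun j => ?_) j <;> refine Fin.cases ?_ (fun k => ?_) k
    · simpa using h0
    · rw [dist_comm]
      exact dist_tupleBary_le hQ v hv (hw k)
    · exact dist_tupleBary_le hQ v hv (hw j)
    · exact hw' j k
termination_by n

lemma tupleSd_iterate_mem_small {Q : Set W} (hQ : Convex ℝ Q) (n : ℕ) (v : Fin (n + 1) → Q)
    {r : ℝ} (hv : ∀ i j, dist (v i) (v j) ≤ r) (N : ℕ) :
    (tupleSd hQ (n + 1))^[N] (.single v 1) ∈ Finsupp.supported ℤ ℤ
      {w : Fin (n + 1) → Q | ∀ i j, dist (w i) (w j) ≤ (n / (n + 1) : ℝ) ^ N * r} := by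
  induction N with
  | zero => simpa using Finsupp.single_mem_supported ℤ (s := {w : Fin (n + 1) → Q |
      ∀ i j, dist (w i) (w j) ≤ r}) (1 : ℤ) hv
  | succ N ih =>
    rw [Function.iterate_succ_apply']
    refine linearMap_mem_of_supported _ _ (fun w hw => ?_) ih
    refine Finsupp.supported_mono ?_ (tupleSd_mem_small hQ n w hw)
    rintro x ⟨-, hx⟩
    rw [pow_succ', mul_assoc]
    exact hx

end Subdivision
end

noncomputable section

/-! ### Augmented singular chains -/

section SingularChains

/-- Singular chains, graded by the number of vertices; there is one simplex without vertices. -/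
abbrev SingChain (X : Type*) [TopologicalSpace X] (n : ℕ) : Type _ :=
  C(stdSimplex ℝ (Fin n), X) →₀ ℤ

variable {X Y Z : Type*} [TopologicalSpace X] [TopologicalSpace Y] [TopologicalSpace Z]
variable {W W' : Type*} [NormedAddCommGroup W] [NormedSpace ℝ W]
  [NormedAddCommGroup W'] [NormedSpace ℝ W']

namespace SingChain

/-- The augmented singular boundary. -/
def bdry (X : Type*) [TopologicalSpace X] (n : ℕ) : SingChain X (n + 1) →ₗ[ℤ] SingChain X n :=
  ∑ i : Fin (n + 1), (-1 : ℤ) ^ (i : ℕ) • Finsupp.lmapDomain ℤ ℤ (fun α => α.comp (faceIncl n i))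

/-- The map on singular chains induced by a continuous map. -/
def push (f : C(X, Y)) (n : ℕ) : SingChain X n →ₗ[ℤ] SingChain Y n :=
  Finsupp.lmapDomain ℤ ℤ (fun α => f.comp α)

/-- The singular chain of affine simplices associated with a tuple chain. -/
def real {Q : Set W} (hQ : Convex ℝ Q) (τ : C(Q, X)) (n : ℕ) : TupleChain Q n →ₗ[ℤ] SingChain X n :=
  Finsupp.lmapDomain ℤ ℤ (fun v => τ.comp (affSimplex hQ v))

/-- The singular chains supported in a subset. -/
def inside (S : Set X) (n : ℕ) : Submodule ℤ (SingChain X n) :=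
  Finsupp.supported ℤ ℤ {α | ∀ t, α t ∈ S}

lemma bdry_single (n : ℕ) (α : C(stdSimplex ℝ (Fin (n + 1)), X)) :
    bdry X n (.single α 1) =
      ∑ i : Fin (n + 1), (-1 : ℤ) ^ (i : ℕ) • .single (α.comp (faceIncl n i)) 1 := by
  simp only [bdry, LinearMap.sum_apply, LinearMap.smul_apply, Finsupp.lmapDomain_apply,
    Finsupp.mapDomain_single]

@[simp] lemma push_single (f : C(X, Y)) (n : ℕ) (α : C(stdSimplex ℝ (Fin n), X)) (k : ℤ) :
    push f n (.single α k) = .single (f.comp α) k := by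
  simp [push, Finsupp.mapDomain_single]

@[simp] lemma real_single {Q : Set W} (hQ : Convex ℝ Q) (τ : C(Q, X)) (n : ℕ) (v : Fin n → Q)
    (k : ℤ) : real hQ τ n (.single v k) = .single (τ.comp (affSimplex hQ v)) k := by
  simp [real, Finsupp.mapDomain_single]

lemma push_push (f : C(X, Y)) (g : C(Y, Z)) (n : ℕ) (c : SingChain X n) :
    push g n (push f n c) = push (g.comp f) n c := by
  suffices push g n ∘ₗ push f n = push (g.comp f) n from DFunLike.congr_fun this c
  ext v : 2
  simp [ContinuousMap.comp_assoc]

lemma bdry_push (f : C(X, Y)) (n : ℕ) (c : SingChain X (n + 1)) :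
    bdry Y n (push f (n + 1) c) = push f n (bdry X n c) := by
  suffices bdry Y n ∘ₗ push f (n + 1) = push f n ∘ₗ bdry X n from DFunLike.congr_fun this c
  ext v : 2
  simp only [LinearMap.comp_apply, Finsupp.lsingle_apply, push_single, bdry_single, map_sum,
    map_smul, ContinuousMap.comp_assoc]

lemma bdry_real {Q : Set W} (hQ : Convex ℝ Q) (τ : C(Q, X)) (n : ℕ) (c : TupleChain Q (n + 1)) :
    bdry X n (real hQ τ (n + 1) c) = real hQ τ n (TupleChain.d Q n c) := by
  suffices bdry X n ∘ₗ real hQ τ (n + 1) = real hQ τ n ∘ₗ TupleChain.d Q n from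
    DFunLike.congr_fun this c
  ext v : 2
  simp only [LinearMap.comp_apply, Finsupp.lsingle_apply, real_single, bdry_single, map_sum,
    map_smul, ContinuousMap.comp_assoc, TupleChain.d_single, affSimplex_comp_faceIncl]

lemma real_map {Q : Set W} (hQ : Convex ℝ Q) {Q' : Set W'} (hQ' : Convex ℝ Q') (τ : C(Q', X))
    (g : C(Q, Q')) (hg : IsAffineMap hQ hQ' g) (n : ℕ) (c : TupleChain Q n) :
    real hQ' τ n (TupleChain.map g n c) = real hQ (τ.comp g) n c := by
  suffices real hQ' τ n ∘ₗ TupleChain.map g n = real hQ (τ.comp g) n from DFunLike.congr_fun this c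
  ext v : 2
  simp only [LinearMap.comp_apply, Finsupp.lsingle_apply, real_single, TupleChain.map_single]
  congr 1
  ext t
  exact congrArg τ (hg n v t).symm

/-- The tuple of vertices of the standard simplex is the universal example: identities for singular
chains follow from identities for this one tuple. -/
lemma single_eq_real (n : ℕ) (α : C(stdSimplex ℝ (Fin n), X)) :
    (.single α 1 : SingChain X n) =
      real (convex_stdSimplex ℝ (Fin n)) α n (.single (stdVertices n) 1) := by
  rw [real_single, affSimplex_self, ContinuousMap.comp_id]

lemma bdry_bdry (n : ℕ) (c : SingChain X (n + 2)) : bdry X n (bdry X (n + 1) c) = 0 := by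
  suffices bdry X n ∘ₗ bdry X (n + 1) = 0 from DFunLike.congr_fun this c
  ext v : 2
  simp only [LinearMap.comp_apply, Finsupp.lsingle_apply]
  rw [single_eq_real, bdry_real, bdry_real, TupleChain.d_d]
  simp

lemma inside_mono {S T : Set X} (h : S ⊆ T) (n : ℕ) : inside S n ≤ inside T n :=
  Finsupp.supported_mono fun _ hα t => h (hα t)

lemma inside_univ (n : ℕ) (c : SingChain X n) : c ∈ inside univ n :=
  fun _ _ _ => mem_univ _

lemma single_mem_inside {S : Set X} {n : ℕ} {α : C(stdSimplex ℝ (Fin n), X)} (h : ∀ t, α t ∈ S)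
    (k : ℤ) : (.single α k : SingChain X n) ∈ inside S n :=
  Finsupp.single_mem_supported ℤ _ h

lemma inside_empty {n : ℕ} {c : SingChain X (n + 1)} (h : c ∈ inside (∅ : Set X) (n + 1)) :
    c = 0 := by
  rw [← Finsupp.support_eq_empty, Finset.eq_empty_iff_forall_notMem]
  exact fun α hα => (h hα (stdSimplex.vertex 0)).elim

lemma push_mem_inside {S : Set X} {T : Set Y} {f : C(X, Y)} (h : ∀ x ∈ S, f x ∈ T) {n : ℕ}
    {c : SingChain X n} (hc : c ∈ inside S n) : push f n c ∈ inside T n := by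
  refine linearMap_mem_of_supported _ _ (fun α hα => ?_) hc
  rw [push_single]
  exact single_mem_inside (fun t => h _ (hα t)) _

lemma bdry_mem_inside {S : Set X} {n : ℕ} {c : SingChain X (n + 1)} (hc : c ∈ inside S (n + 1)) :
    bdry X n c ∈ inside S n := by
  refine linearMap_mem_of_supported _ _ (fun α hα => ?_) hc
  rw [bdry_single]
  exact Submodule.sum_mem _ fun i _ => Submodule.smul_mem _ _
    (single_mem_inside (S := S) (fun t => hα (faceIncl n i t)) 1)

lemma real_mem_inside {Q : Set W} (hQ : Convex ℝ Q) {τ : C(Q, X)} {S : Set X} (h : ∀ x, τ x ∈ S)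
    (n : ℕ) (c : TupleChain Q n) : real hQ τ n c ∈ inside S n := by
  refine linearMap_mem_of_supported (s := univ) _ _ (fun v _ => ?_) (fun _ _ => mem_univ _)
  rw [real_single]
  exact single_mem_inside (fun t => h _) _

/-- Chains supported in `S` come from the subspace `S`. -/
lemma exists_push_eq {S : Set X} {n : ℕ} {c : SingChain X n} (hc : c ∈ inside S n) :
    ∃ c' : SingChain S n, push ⟨Subtype.val, continuous_subtype_val⟩ n c' = c := by
  have := linearMap_mem_of_supported LinearMap.id
    (LinearMap.range (push (⟨Subtype.val, continuous_subtype_val⟩ : C(S, X)) n)) (fun α hα => ?_) hc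
  · exact this
  · refine ⟨.single ⟨fun t => ⟨α t, hα t⟩, by fun_prop⟩ 1, ?_⟩
    rw [push_single]
    rfl

/-- Composition with the inclusion is injective on simplices, so no cancellation occurs and the
support can be read off in the ambient space. -/
lemma mem_inside_of_push {S T : Set X} {n : ℕ} {c : SingChain S n}
    (h : push ⟨Subtype.val, continuous_subtype_val⟩ n c ∈ inside T n) :
    c ∈ inside (Subtype.val ⁻¹' T) n := by
  intro α hα t
  have hinj : Function.Injective
      (fun α : C(stdSimplex ℝ (Fin n), S) =>
        (⟨Subtype.val, continuous_subtype_val⟩ : C(S, X)).comp α) := by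
    intro α τ hατ
    ext t
    exact DFunLike.congr_fun hατ t
  have h1 : (⟨Subtype.val, continuous_subtype_val⟩ : C(S, X)).comp α ∈
      (push (⟨Subtype.val, continuous_subtype_val⟩ : C(S, X)) n c).support := by
    rw [Finsupp.mem_support_iff, push, Finsupp.lmapDomain_apply,
      Finsupp.mapDomain_apply hinj]
    exact Finsupp.mem_support_iff.1 hα
  exact h h1 t

/-- The operator on singular chains which sends `α` to the image of a fixed tuple chain under a
map `hat α`. -/
def natOp {n m : ℕ} {Q : Set W} (hQ : Convex ℝ Q) (hat : C(stdSimplex ℝ (Fin n), X) → C(Q, Y))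
    (c : TupleChain Q m) : SingChain X n →ₗ[ℤ] SingChain Y m :=
  Finsupp.linearCombination ℤ fun α => real hQ (hat α) m c

lemma natOp_single {n m : ℕ} {Q : Set W} (hQ : Convex ℝ Q)
    (hat : C(stdSimplex ℝ (Fin n), X) → C(Q, Y)) (c : TupleChain Q m)
    (α : C(stdSimplex ℝ (Fin n), X)) : natOp hQ hat c (.single α 1) = real hQ (hat α) m c := by
  simp [natOp]

lemma bdry_comp_natOp {n m : ℕ} {Q : Set W} (hQ : Convex ℝ Q)
    (hat : C(stdSimplex ℝ (Fin n), X) → C(Q, Y)) (c : TupleChain Q (m + 1)) :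
    bdry Y m ∘ₗ natOp hQ hat c = natOp hQ hat (TupleChain.d Q m c) := by
  ext α : 2
  simp only [LinearMap.comp_apply, Finsupp.lsingle_apply, natOp_single, bdry_real]

/-- If restricting `hat'` along the affine maps `e i` gives `hat` of the faces, the faces of a
singular simplex can be traded for images of tuples in the model. This turns boundary formulas for
tuples into boundary formulas for singular chains. -/
lemma natOp_comp_bdry {n m : ℕ} {Q : Set W} (hQ : Convex ℝ Q) {Q' : Set W'} (hQ' : Convex ℝ Q')
    (hat : C(stdSimplex ℝ (Fin n), X) → C(Q, Y)) (hat' : C(stdSimplex ℝ (Fin (n + 1)), X) → C(Q', Y))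
    (e : Fin (n + 1) → C(Q, Q')) (he : ∀ i, IsAffineMap hQ hQ' (e i))
    (hh : ∀ α i, hat (α.comp (faceIncl n i)) = (hat' α).comp (e i)) (c : TupleChain Q m) :
    natOp hQ hat c ∘ₗ bdry X n =
      natOp hQ' hat' (∑ i : Fin (n + 1), (-1 : ℤ) ^ (i : ℕ) • TupleChain.map (e i) m c) := by
  ext α : 2
  simp only [LinearMap.comp_apply, Finsupp.lsingle_apply, natOp_single, bdry_single, map_sum,
    map_smul, hh, real_map _ _ _ _ (he _)]

lemma natOp_sub {n m : ℕ} {Q : Set W} (hQ : Convex ℝ Q)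
    (hat : C(stdSimplex ℝ (Fin n), X) → C(Q, Y)) (c c' : TupleChain Q m) :
    natOp hQ hat (c - c') = natOp hQ hat c - natOp hQ hat c' := by
  ext α : 2
  simp only [LinearMap.comp_apply, Finsupp.lsingle_apply, natOp_single, LinearMap.sub_apply,
    map_sub]

lemma natOp_mem_inside {n m : ℕ} {Q : Set W} (hQ : Convex ℝ Q)
    {hat : C(stdSimplex ℝ (Fin n), X) → C(Q, Y)} (c : TupleChain Q m) {S : Set X} {T : Set Y}
    (h : ∀ α, (∀ t, α t ∈ S) → ∀ x, hat α x ∈ T) {z : SingChain X n} (hz : z ∈ inside S n) :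
    natOp hQ hat c z ∈ inside T m := by
  refine linearMap_mem_of_supported _ _ (fun α hα => ?_) hz
  rw [natOp_single]
  exact real_mem_inside _ (h α hα) _ _

/-! ### Subdivision of singular chains -/

/-- Barycentric subdivision of singular chains. -/
def sd (X : Type*) [TopologicalSpace X] (n : ℕ) : SingChain X n →ₗ[ℤ] SingChain X n :=
  natOp (convex_stdSimplex ℝ (Fin n)) id
    (tupleSd (convex_stdSimplex ℝ (Fin n)) n (.single (stdVertices n) 1))

/-- The chain homotopy between the identity and barycentric subdivision. -/
def sdHomotopy (X : Type*) [TopologicalSpace X] (n : ℕ) :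
    SingChain X n →ₗ[ℤ] SingChain X (n + 1) :=
  natOp (convex_stdSimplex ℝ (Fin n)) id
    (tupleSdHomotopy (convex_stdSimplex ℝ (Fin n)) n (.single (stdVertices n) 1))

lemma sdHomotopy_zero : sdHomotopy X 0 = 0 := by
  ext α : 2
  simp [sdHomotopy, natOp_single, tupleSdHomotopy, TupleChain.coneHomotopy]

lemma isAffineMap_faceIncl (n : ℕ) (i : Fin (n + 1)) :
    IsAffineMap (convex_stdSimplex ℝ (Fin n)) (convex_stdSimplex ℝ (Fin (n + 1)))
      (faceIncl n i) := by
  rw [faceIncl_eq_affSimplex]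
  exact isAffineMap_affSimplex _ _

lemma d_tupleSdHomotopy {Q : Set W} (hQ : Convex ℝ Q) (n : ℕ) (c : TupleChain Q (n + 1)) :
    TupleChain.d Q (n + 1) (tupleSdHomotopy hQ (n + 1) c) =
      c - tupleSd hQ (n + 1) c - tupleSdHomotopy hQ n (TupleChain.d Q n c) :=
  DFunLike.congr_fun (TupleChain.coneHomotopy_spec (tupleBary hQ) (fun _ => LinearMap.id)
    (tupleSd hQ) rfl (fun _ => rfl) (d_comp_tupleSd hQ) n) c

lemma bdry_sdHomotopy (n : ℕ) (z : SingChain X (n + 1)) :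
    bdry X (n + 1) (sdHomotopy X (n + 1) z) =
      z - sd X (n + 1) z - sdHomotopy X n (bdry X n z) := by
  suffices bdry X (n + 1) ∘ₗ sdHomotopy X (n + 1) =
    LinearMap.id - sd X (n + 1) - sdHomotopy X n ∘ₗ bdry X n from DFunLike.congr_fun this z
  have h1 : sdHomotopy X n ∘ₗ bdry X n = natOp (convex_stdSimplex ℝ (Fin (n + 1))) id
      (tupleSdHomotopy (convex_stdSimplex ℝ (Fin (n + 1))) n
        (TupleChain.d _ n (.single (stdVertices (n + 1)) 1))) := by
    refine (natOp_comp_bdry _ (convex_stdSimplex ℝ (Fin (n + 1))) _ id (faceIncl n)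
      (isAffineMap_faceIncl n) (fun _ _ => rfl) _).trans ?_
    simp only [map_tupleSdHomotopy _ _ (isAffineMap_faceIncl n _), TupleChain.map_single,
      faceIncl_comp_stdVertices, TupleChain.d_single, map_sum, map_smul]
  have h2 : (LinearMap.id : SingChain X (n + 1) →ₗ[ℤ] SingChain X (n + 1)) =
      natOp (convex_stdSimplex ℝ (Fin (n + 1))) id (.single (stdVertices (n + 1)) 1) := by
    ext α : 2
    simp only [LinearMap.comp_apply, Finsupp.lsingle_apply, natOp_single, LinearMap.id_apply]
    exact single_eq_real _ α
  rw [h1, h2, sd, sdHomotopy, bdry_comp_natOp, ← natOp_sub, ← natOp_sub]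
  rw [d_tupleSdHomotopy]

/-- Subdivision commutes with affine maps, so iterated subdivisions of affine chains remain affine
and the metric estimates for tuples apply. -/
lemma sd_real {Q : Set W} (hQ : Convex ℝ Q) (τ : C(Q, X)) (n : ℕ) (c : TupleChain Q n) :
    sd X n (real hQ τ n c) = real hQ τ n (tupleSd hQ n c) := by
  suffices sd X n ∘ₗ real hQ τ n = real hQ τ n ∘ₗ tupleSd hQ n from DFunLike.congr_fun this c
  ext v : 2
  simp only [LinearMap.comp_apply, Finsupp.lsingle_apply, real_single]
  rw [sd, natOp_single, id, ← real_map (convex_stdSimplex ℝ (Fin n)) hQ τ (affSimplex hQ v)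
    (isAffineMap_affSimplex hQ v), map_tupleSd _ hQ (isAffineMap_affSimplex hQ v),
    TupleChain.map_single, affSimplex_stdVertices]

lemma sd_iterate_real {Q : Set W} (hQ : Convex ℝ Q) (τ : C(Q, X)) (n : ℕ) (c : TupleChain Q n)
    (N : ℕ) : (sd X n)^[N] (real hQ τ n c) = real hQ τ n ((tupleSd hQ n)^[N] c) := by
  induction N with
  | zero => rfl
  | succ N ih => rw [Function.iterate_succ_apply', Function.iterate_succ_apply', ih, sd_real]

lemma sd_mem_inside {S : Set X} {n : ℕ} {z : SingChain X n} (hz : z ∈ inside S n) :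
    sd X n z ∈ inside S n :=
  natOp_mem_inside _ _ (fun _ h => h) hz

lemma sdHomotopy_mem_inside {S : Set X} {n : ℕ} {z : SingChain X n} (hz : z ∈ inside S n) :
    sdHomotopy X n z ∈ inside S (n + 1) :=
  natOp_mem_inside _ _ (fun _ h => h) hz

-- The preimages of U and V cover a compact simplex. Once the diameters (n / (n + 1)) ^ N * r drop
-- below a Lebesgue number, each small simplex lies in one of the two.
open Filter in
lemma eventually_sd_single_mem {S U V : Set X} (hU : IsOpen U) (hV : IsOpen V) (hS : S ⊆ U ∪ V)
    {n : ℕ} (α : C(stdSimplex ℝ (Fin (n + 1)), X)) (hα : ∀ t, α t ∈ S) :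
    ∀ᶠ N in atTop, (sd X (n + 1))^[N] (.single α 1) ∈
      inside (S ∩ U) (n + 1) ⊔ inside (S ∩ V) (n + 1) := by
  obtain ⟨δ, hδ, hleb⟩ := lebesgue_number_lemma_of_metric (s := univ)
    (c := fun b : Bool => α ⁻¹' (if b then U else V)) isCompact_univ
    (fun b => by cases b <;> simpa using IsOpen.preimage α.continuous ‹_›)
    (fun t _ => by
      rcases hS (hα t) with h | h
      · exact mem_iUnion.2 ⟨true, by simpa using h⟩
      · exact mem_iUnion.2 ⟨false, by simpa using h⟩)
  obtain ⟨r, hr⟩ : ∃ r, ∀ i j, dist (stdVertices (n + 1) i) (stdVertices (n + 1) j) ≤ r := by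
    obtain ⟨r, hr⟩ := (Metric.isBounded_iff (s := (univ : Set (stdSimplex ℝ (Fin (n + 1)))))).1
      isCompact_univ.isBounded
    exact ⟨r, fun i j => hr (mem_univ _) (mem_univ _)⟩
  have hlim : Tendsto (fun N : ℕ => (n / (n + 1) : ℝ) ^ N * r) atTop (𝓝 (0 * r)) := by
    refine (tendsto_pow_atTop_nhds_zero_of_lt_one (by positivity) ?_).mul_const r
    rw [div_lt_one (by positivity)]
    linarith
  rw [zero_mul] at hlim
  filter_upwards [hlim.eventually_lt_const hδ] with N hN
  rw [single_eq_real, sd_iterate_real]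
  refine linearMap_mem_of_supported _ _ (fun v hv => ?_)
    (tupleSd_iterate_mem_small (convex_stdSimplex ℝ (Fin (n + 1))) n (stdVertices (n + 1)) hr N)
  rw [real_single]
  let τ := affSimplex (convex_stdSimplex ℝ (Fin (n + 1))) v
  obtain ⟨b, hb⟩ := hleb (τ (stdSimplex.vertex 0)) (mem_univ _)
  have hmem : ∀ t, τ t ∈ α ⁻¹' (if b then U else V) := fun t =>
    hb (Metric.mem_ball.2 ((dist_affSimplex_le _ v hv _ _).trans_lt hN))
  cases b
  · exact Submodule.mem_sup_right (single_mem_inside (S := S ∩ V)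
      (fun t => ⟨hα (τ t), by simpa using hmem t⟩) 1)
  · exact Submodule.mem_sup_left (single_mem_inside (S := S ∩ U)
      (fun t => ⟨hα (τ t), by simpa using hmem t⟩) 1)

/-- The theorem on small simplices. -/
lemma exists_sd_mem {S U V : Set X} (hU : IsOpen U) (hV : IsOpen V) (hS : S ⊆ U ∪ V)
    {n : ℕ} {z : SingChain X (n + 1)} (hz : z ∈ inside S (n + 1)) :
    ∃ N, (sd X (n + 1))^[N] z ∈ inside (S ∩ U) (n + 1) ⊔ inside (S ∩ V) (n + 1) := by
  -- Asking for all large N, and not just for one, gives the finitely many simplices of a chain a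
  -- common N.
  suffices ∀ᶠ N in Filter.atTop, (sd X (n + 1) ^ N) z ∈
      inside (S ∩ U) (n + 1) ⊔ inside (S ∩ V) (n + 1) by
    simpa only [Module.End.pow_apply] using this.exists
  rw [inside, Finsupp.supported_eq_span_single] at hz
  induction hz using Submodule.span_induction with
  | mem x hx =>
    obtain ⟨α, hα, rfl⟩ := hx
    simpa only [Module.End.pow_apply] using eventually_sd_single_mem hU hV hS α hα
  | zero => simp
  | add x y _ _ ihx ihy =>
    filter_upwards [ihx, ihy] with N h1 h2
    rw [map_add]
    exact add_mem h1 h2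
  | smul k x _ ihx =>
    filter_upwards [ihx] with N h1
    rw [map_smul]
    exact Submodule.smul_mem _ _ h1

/-! ### The prism operator -/

/-- The convex prism over a simplex. -/
def prismSet (n : ℕ) : Set (ℝ × (Fin n → ℝ)) := Icc 0 1 ×ˢ stdSimplex ℝ (Fin n)

lemma convex_prismSet (n : ℕ) : Convex ℝ (prismSet n) :=
  (convex_Icc 0 1).prod (convex_stdSimplex ℝ (Fin n))

/-- The horizontal slices of the prism. -/
def prismSlice (n : ℕ) (s : I) : C(stdSimplex ℝ (Fin n), prismSet n) :=
  ⟨fun t => ⟨(s.1, t.1), s.2, t.2⟩, by fun_prop⟩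

/-- The faces of the prism over the faces of the simplex. -/
def prismFace (n : ℕ) (i : Fin (n + 1)) : C(prismSet n, prismSet (n + 1)) :=
  ⟨fun x => ⟨(x.1.1, (faceIncl n i ⟨x.1.2, x.2.2⟩).1), x.2.1, Subtype.coe_prop _⟩, by fun_prop⟩

lemma isAffineMap_prismSlice (n : ℕ) (s : I) :
    IsAffineMap (convex_stdSimplex ℝ (Fin n)) (convex_prismSet n) (prismSlice n s) := by
  intro m v t
  apply Subtype.ext
  refine Prod.ext ?_ ?_
  · rw [affSimplex_coe, Prod.fst_sum]
    simp only [prismSlice, Function.comp_apply, ContinuousMap.coe_mk, Prod.smul_mk, smul_eq_mul]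
    rw [← Finset.sum_mul, stdSimplex.sum_eq_one, one_mul]
  · rw [affSimplex_coe, Prod.snd_sum]
    simp only [prismSlice, Function.comp_apply, ContinuousMap.coe_mk, Prod.smul_mk, affSimplex_coe]

lemma isAffineMap_prismFace (n : ℕ) (i : Fin (n + 1)) :
    IsAffineMap (convex_prismSet n) (convex_prismSet (n + 1)) (prismFace n i) := by
  intro m v t
  have h : (⟨(affSimplex (convex_prismSet n) v t).1.2, (affSimplex (convex_prismSet n) v t).2.2⟩ :
      stdSimplex ℝ (Fin n)) =
      affSimplex (convex_stdSimplex ℝ (Fin n)) (fun i => ⟨(v i).1.2, (v i).2.2⟩) t := by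
    apply Subtype.ext
    simp only [affSimplex_coe, Prod.snd_sum, Prod.smul_snd]
  apply Subtype.ext
  refine Prod.ext ?_ ?_
  · simp only [prismFace, ContinuousMap.coe_mk, affSimplex_coe, Prod.fst_sum, Prod.smul_fst,
      Function.comp_apply]
  · rw [affSimplex_coe, Prod.snd_sum]
    change (faceIncl n i ⟨(affSimplex (convex_prismSet n) v t).1.2, _⟩).1 = _
    rw [h, isAffineMap_faceIncl n i m _ t, affSimplex_coe]
    rfl

/-- The prism operator on tuple chains. -/
def tuplePrism (k n : ℕ) : TupleChain (stdSimplex ℝ (Fin k)) n →ₗ[ℤ]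
    TupleChain (prismSet k) (n + 1) :=
  TupleChain.coneHomotopy (fun _ v => prismSlice k 0 (v 0)) (TupleChain.map (prismSlice k 1))
    (TupleChain.map (prismSlice k 0)) n

lemma d_tuplePrism (k n : ℕ) (c : TupleChain (stdSimplex ℝ (Fin k)) (n + 1)) :
    TupleChain.d (prismSet k) (n + 1) (tuplePrism k (n + 1) c) =
      TupleChain.map (prismSlice k 1) (n + 1) c - TupleChain.map (prismSlice k 0) (n + 1) c -
        tuplePrism k n (TupleChain.d _ n c) := by
  refine DFunLike.congr_fun (TupleChain.coneHomotopy_spec (fun _ v => prismSlice k 0 (v 0))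
    (TupleChain.map (prismSlice k 1)) (TupleChain.map (prismSlice k 0)) ?_
    (fun n => LinearMap.ext (TupleChain.d_map _ n))
    (fun n => LinearMap.ext (TupleChain.d_map _ n)) n) c
  ext v : 2
  simp only [LinearMap.comp_apply, Finsupp.lsingle_apply, TupleChain.map_single]
  congr 1
  exact Subsingleton.elim _ _

lemma map_tuplePrism (k : ℕ) (i : Fin (k + 1)) (n : ℕ)
    (c : TupleChain (stdSimplex ℝ (Fin k)) n) :
    TupleChain.map (prismFace k i) (n + 1) (tuplePrism k n c) =
      tuplePrism (k + 1) n (TupleChain.map (faceIncl k i) n c) :=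
  TupleChain.coneHomotopy_natural _ _ _ _ _ _ _ _ (fun _ _ => rfl)
    (fun _ _ => by rw [TupleChain.map_map, TupleChain.map_map]; rfl)
    (fun _ _ => by rw [TupleChain.map_map, TupleChain.map_map]; rfl) _ _

/-- The map of the prism over a singular simplex determined by a homotopy. -/
def prismHat (K : C(I × X, Y)) (n : ℕ) (α : C(stdSimplex ℝ (Fin n), X)) : C(prismSet n, Y) :=
  ⟨fun x => K (⟨x.1.1, x.2.1⟩, α ⟨x.1.2, x.2.2⟩), by fun_prop⟩

/-- The prism operator of a homotopy. -/
def prism (K : C(I × X, Y)) (n : ℕ) : SingChain X n →ₗ[ℤ] SingChain Y (n + 1) :=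
  natOp (convex_prismSet n) (prismHat K n) (tuplePrism n n (.single (stdVertices n) 1))

/-- The empty simplex has no prism. Hence the augmentation term disappears from the homotopy formula
in degree zero, and the augmented chains still compute unreduced homology there. -/
lemma prism_zero (K : C(I × X, Y)) : prism K 0 = 0 := by
  ext α : 2
  simp [prism, natOp_single, tuplePrism, TupleChain.coneHomotopy]

/-- A stage of a homotopy. -/
def stage (K : C(I × X, Y)) (s : I) : C(X, Y) := ⟨fun x => K (s, x), by fun_prop⟩

lemma natOp_prismSlice (K : C(I × X, Y)) (n : ℕ) (s : I) :
    natOp (convex_prismSet n) (prismHat K n)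
      (TupleChain.map (prismSlice n s) n (.single (stdVertices n) 1)) = push (stage K s) n := by
  ext α : 2
  simp only [LinearMap.comp_apply, Finsupp.lsingle_apply, natOp_single]
  rw [real_map (convex_stdSimplex ℝ (Fin n)) _ _ _ (isAffineMap_prismSlice n s), real_single,
    affSimplex_self, push_single]
  rfl

lemma bdry_prism (K : C(I × X, Y)) (n : ℕ) (z : SingChain X (n + 1)) :
    bdry Y (n + 1) (prism K (n + 1) z) =
      push (stage K 1) (n + 1) z - push (stage K 0) (n + 1) z - prism K n (bdry X n z) := by
  suffices bdry Y (n + 1) ∘ₗ prism K (n + 1) = push (stage K 1) (n + 1) - push (stage K 0) (n + 1) -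
    prism K n ∘ₗ bdry X n from DFunLike.congr_fun this z
  have h1 : prism K n ∘ₗ bdry X n = natOp (convex_prismSet (n + 1)) (prismHat K (n + 1))
      (tuplePrism (n + 1) n (TupleChain.d _ n (.single (stdVertices (n + 1)) 1))) := by
    refine (natOp_comp_bdry _ (convex_prismSet (n + 1)) _ (prismHat K (n + 1)) (prismFace n)
      (isAffineMap_prismFace n) (fun _ _ => rfl) _).trans ?_
    simp only [map_tuplePrism, TupleChain.map_single,
      faceIncl_comp_stdVertices, TupleChain.d_single, map_sum, map_smul]
  rw [h1, ← natOp_prismSlice, ← natOp_prismSlice, prism, bdry_comp_natOp, ← natOp_sub, ← natOp_sub]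
  rw [d_tuplePrism]

lemma prism_mem_inside {K : C(I × X, Y)} {S : Set X} {T : Set Y} (h : ∀ s, ∀ x ∈ S, K (s, x) ∈ T)
    {n : ℕ} {z : SingChain X n} (hz : z ∈ inside S n) : prism K n z ∈ inside T (n + 1) :=
  natOp_mem_inside _ _ (fun _ h' _ => h _ _ (h' _)) hz

end SingChain
end SingularChains
end

noncomputable section

/-! ### Iterated differences of cycles -/

namespace SingChain

variable {E : Type*} [TopologicalSpace E] {ι : Type*}

/-- The condition on a singular chain (of dimension `n`) to be a cycle for the non-augmented
boundary. -/
def IsCycle : ∀ n, SingChain E (n + 1) → Prop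
  | 0, _ => True
  | n + 1, z => bdry E (n + 1) z = 0

/-- All `r`-fold differences of `z` with respect to a family of self-maps are boundaries of chains
in `W`. -/
def Kill (act : ι → C(E, E)) (W : Set E) (n : ℕ) : ℕ → SingChain E (n + 1) → Prop
  | 0, z => ∃ w ∈ inside W (n + 2), bdry E (n + 1) w = z
  | r + 1, z => ∀ a, Kill act W n r (push (act a) (n + 1) z - z)

variable {act : ι → C(E, E)} {W : Set E} {n : ℕ}

lemma IsCycle.sub_push {z : SingChain E (n + 1)} (hz : IsCycle n z) (f : C(E, E)) :
    IsCycle n (push f (n + 1) z - z) := by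
  cases n with
  | zero => trivial
  | succ n =>
    change bdry E (n + 1) _ = 0
    change bdry E (n + 1) _ = 0 at hz
    rw [map_sub, bdry_push, hz, map_zero, sub_zero]

lemma IsCycle.of_sub_eq_bdry {z z' : SingChain E (n + 1)} (hz : IsCycle n z)
    {w : SingChain E (n + 2)} (h : z - z' = bdry E (n + 1) w) : IsCycle n z' := by
  cases n with
  | zero => trivial
  | succ n =>
    change bdry E (n + 1) _ = 0
    change bdry E (n + 1) _ = 0 at hz
    rw [← sub_sub_cancel z z', h, map_sub, hz, bdry_bdry, sub_zero]

lemma kill_add {r : ℕ} {z z' : SingChain E (n + 1)} (h : Kill act W n r z)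
    (h' : Kill act W n r z') : Kill act W n r (z + z') := by
  induction r generalizing z z' with
  | zero =>
    obtain ⟨w, hw, rfl⟩ := h
    obtain ⟨w', hw', rfl⟩ := h'
    exact ⟨w + w', add_mem hw hw', map_add _ _ _⟩
  | succ r ih =>
    intro a
    rw [map_add, add_sub_add_comm]
    exact ih (h a) (h' a)

lemma kill_mono {W' : Set E} (hW : W ⊆ W') {r : ℕ} {z : SingChain E (n + 1)}
    (h : Kill act W n r z) : Kill act W' n r z := by
  induction r generalizing z with
  | zero =>
    obtain ⟨w, hw, rfl⟩ := h
    exact ⟨w, inside_mono hW _ hw, rfl⟩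
  | succ r ih => exact fun a => ih (h a)

lemma kill_bdry (hW : ∀ a, ∀ x ∈ W, act a x ∈ W) (r : ℕ) {w : SingChain E (n + 2)}
    (hw : w ∈ inside W (n + 2)) : Kill act W n r (bdry E (n + 1) w) := by
  induction r generalizing w with
  | zero => exact ⟨w, hw, rfl⟩
  | succ r ih =>
    intro a
    rw [← bdry_push, ← map_sub]
    exact ih (sub_mem (push_mem_inside (hW a) hw) hw)

/-- As W is stable under the maps, differences of boundaries in W are again boundaries in W. So
being killed depends only on the homology class in W. -/
lemma kill_of_sub_eq_bdry (hW : ∀ a, ∀ x ∈ W, act a x ∈ W) {r : ℕ} {z z' : SingChain E (n + 1)}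
    (hz' : Kill act W n r z') {w : SingChain E (n + 2)} (hw : w ∈ inside W (n + 2))
    (h : z - z' = bdry E (n + 1) w) : Kill act W n r z := by
  rw [← sub_add_cancel z z', h]
  exact kill_add (kill_bdry hW r hw) hz'

lemma exists_sub_sd_iterate_eq_bdry {z : SingChain E (n + 1)} (hzW : z ∈ inside W (n + 1))
    (hz : IsCycle n z) (N : ℕ) :
    (sd E (n + 1))^[N] z ∈ inside W (n + 1) ∧
    ∃ w ∈ inside W (n + 2), z - (sd E (n + 1))^[N] z = bdry E (n + 1) w := by
  induction N with
  | zero => exact ⟨hzW, 0, zero_mem _, by simp⟩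
  | succ N ih =>
    obtain ⟨hN, w, hw, hwz⟩ := ih
    rw [Function.iterate_succ_apply']
    refine ⟨sd_mem_inside hN, w + sdHomotopy E (n + 1) ((sd E (n + 1))^[N] z),
      add_mem hw (sdHomotopy_mem_inside hN), ?_⟩
    -- The correction term vanishes for two reasons: in degree zero the homotopy is zero on the
    -- empty simplex, and in positive degree the chain is a cycle.
    have h0 : sdHomotopy E n (bdry E n ((sd E (n + 1))^[N] z)) = 0 := by
      cases n with
      | zero => rw [sdHomotopy_zero, LinearMap.zero_apply]
      | succ n =>
        have h1 : bdry E (n + 1) ((sd E (n + 1 + 1))^[N] z) = 0 :=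
          IsCycle.of_sub_eq_bdry hz hwz
        rw [h1, map_zero]
    rw [map_add, ← hwz, bdry_sdHomotopy, h0]
    abel

/-- The prism of the deformation shows that a cycle in U is homologous, within W, to its final
stage, which lies in S. The deformation need not be compatible with the maps `act a`. -/
lemma kill_of_deformation {S U : Set E} (hW : ∀ a, ∀ x ∈ W, act a x ∈ W) (hUW : U ⊆ W)
    (hSW : S ⊆ W) (K : C(I × W, E)) (hK0 : ∀ y, K (0, y) = y) (hKW : ∀ s y, K (s, y) ∈ W)
    (hK1 : ∀ y : W, (y : E) ∈ U → K (1, y) ∈ S) {r : ℕ}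
    (hS : ∀ z ∈ inside S (n + 1), IsCycle n z → Kill act S n r z)
    {z : SingChain E (n + 1)} (hzU : z ∈ inside U (n + 1)) (hz : IsCycle n z) :
    Kill act W n r z := by
  obtain ⟨z', rfl⟩ := exists_push_eq (inside_mono hUW _ hzU)
  have hz'U := mem_inside_of_push hzU
  have h0 : prism K n (bdry W n z') = 0 := by
    cases n with
    | zero => rw [prism_zero, LinearMap.zero_apply]
    | succ n =>
      have h1 : bdry W (n + 1) z' ∈ inside (∅ : Set W) (n + 1) := by
        have h2 : push ⟨Subtype.val, continuous_subtype_val⟩ (n + 1) (bdry W (n + 1) z') = 0 := by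
          rw [← bdry_push]
          exact hz
        exact mem_inside_of_push (T := (∅ : Set E)) (by rw [h2]; exact zero_mem _)
      rw [inside_empty h1, map_zero]
  have hb : push (stage K 1) (n + 1) z' -
      push ⟨Subtype.val, continuous_subtype_val⟩ (n + 1) z' =
        bdry E (n + 1) (prism K (n + 1) z') := by
    rw [bdry_prism, h0, sub_zero]
    congr 3
    ext y
    exact (hK0 y).symm
  have hw : prism K (n + 1) z' ∈ inside W (n + 2) :=
    prism_mem_inside (S := univ) (fun s x _ => hKW s x) (inside_univ _ _)
  rw [← neg_sub, neg_eq_iff_eq_neg, ← map_neg] at hb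
  refine kill_of_sub_eq_bdry hW (kill_mono hSW (hS _ ?_ (hz.of_sub_eq_bdry hb))) (neg_mem hw) hb
  exact push_mem_inside (fun y hy => hK1 y hy) hz'U

/-- The Mayer-Vietoris step. -/
lemma kill_succ_of_cover {U' V' : Set E} (hU' : IsOpen U') (hV' : IsOpen V') (hcov : W ⊆ U' ∪ V')
    (hW : ∀ a, ∀ x ∈ W, act a x ∈ W) (hU : ∀ a, ∀ x ∈ W ∩ U', act a x ∈ W ∩ U')
    (hV : ∀ a, ∃ K : C(I × ↥(W ∩ V'), E), (∀ y, K (0, y) = y) ∧ (∀ y, K (1, y) = act a y) ∧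
      (∀ s y, K (s, y) ∈ W) ∧ ∀ s (y : ↥(W ∩ V')), (y : E) ∈ W ∩ U' → K (s, y) ∈ W ∩ U')
    {r : ℕ} (hKU : ∀ z ∈ inside (W ∩ U') (n + 1), IsCycle n z → Kill act W n r z)
    {z : SingChain E (n + 1)} (hzW : z ∈ inside W (n + 1)) (hz : IsCycle n z) :
    Kill act W n (r + 1) z := by
  obtain ⟨N, hN⟩ := exists_sd_mem hU' hV' hcov hzW
  obtain ⟨hNW, w, hw, hwz⟩ := exists_sub_sd_iterate_eq_bdry hzW hz N
  refine kill_of_sub_eq_bdry hW (r := r + 1) ?_ hw hwz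
  replace hz := hz.of_sub_eq_bdry hwz
  generalize (sd E (n + 1))^[N] z = z at hN hz
  obtain ⟨x, hx, y, hy, rfl⟩ := Submodule.mem_sup.1 hN
  intro a
  obtain ⟨K, hK0, hK1, hKW, hKU'⟩ := hV a
  obtain ⟨y', rfl⟩ := exists_push_eq hy
  -- Since z is a cycle, ∂y = -∂x lies over both pieces of the cover. The homotopy preserves W ∩ U',
  -- so the side wall of the prism over y stays there.
  have hbU : prism K n (bdry _ n y') ∈ inside (W ∩ U') (n + 1) := by
    cases n with
    | zero =>
      rw [prism_zero, LinearMap.zero_apply]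
      exact zero_mem _
    | succ n =>
      refine prism_mem_inside (S := Subtype.val ⁻¹' (W ∩ U')) (fun s y hy => hKU' s y hy) ?_
      refine mem_inside_of_push ?_
      rw [← bdry_push]
      have h1 : bdry E (n + 1) (x + push ⟨Subtype.val, continuous_subtype_val⟩ (n + 1 + 1) y') = 0 :=
        hz
      rw [map_add, add_eq_zero_iff_neg_eq] at h1
      rw [← h1]
      exact neg_mem (bdry_mem_inside hx)
  have hprism : prism K (n + 1) y' ∈ inside W (n + 2) :=
    prism_mem_inside (S := univ) (fun s x _ => hKW s x) (inside_univ _ _)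
  -- The prism over y trades a y - y for the side wall. What is left is a cycle in W ∩ U', to which
  -- the hypothesis for r applies.
  have key : (push (act a) (n + 1) (x + push ⟨Subtype.val, continuous_subtype_val⟩ (n + 1) y') -
        (x + push ⟨Subtype.val, continuous_subtype_val⟩ (n + 1) y')) -
      (push (act a) (n + 1) x - x + prism K n (bdry _ n y')) =
      bdry E (n + 1) (prism K (n + 1) y') := by
    have e1 : stage K 1 = (act a).comp ⟨Subtype.val, continuous_subtype_val⟩ :=
      ContinuousMap.ext fun y => hK1 y
    have e0 : stage K 0 = ⟨Subtype.val, continuous_subtype_val⟩ :=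
      ContinuousMap.ext fun y => hK0 y
    rw [bdry_prism, e1, e0, ← push_push, map_add]
    abel
  refine kill_of_sub_eq_bdry hW (hKU _ ?_ ((hz.sub_push _).of_sub_eq_bdry key)) hprism key
  exact add_mem (sub_mem (push_mem_inside (hU a) hx) hx) hbU

end SingChain

/-! ### Nilpotent filtrations from iterated differences -/

section Filtration

variable {A : Type v} [Group A] {M : Type u} [AddCommGroup M] [Module ℤ M]

/-- The upper filtration: `m` lies in stage `r` if all `r`-fold differences of `m` vanish. -/
def upperFiltration (ρ : Representation ℤ A M) : ℕ → Submodule ℤ M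
  | 0 => ⊥
  | r + 1 => ⨅ a : A, (upperFiltration ρ r).comap (ρ a - LinearMap.id)

lemma mem_upperFiltration_succ (ρ : Representation ℤ A M) (r : ℕ) (m : M) :
    m ∈ upperFiltration ρ (r + 1) ↔ ∀ a, ρ a m - m ∈ upperFiltration ρ r := by
  simp [upperFiltration, Submodule.mem_iInf]

/-- The stages increase by induction, and each is a submodule for A because ρ(a) m is the sum of m
and of a difference in the same stage. -/
lemma hasNilpotentFiltration_of_upperFiltration (ρ : Representation ℤ A M) (r : ℕ)
    (h : upperFiltration ρ r = ⊤) : HasNilpotentFiltration ρ r := by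
  have hle : ∀ i, upperFiltration ρ i ≤ upperFiltration ρ (i + 1) := by
    intro i
    induction i with
    | zero => exact bot_le
    | succ i ih =>
      intro m hm
      rw [mem_upperFiltration_succ] at hm ⊢
      exact fun a => ih (hm a)
  refine ⟨upperFiltration ρ, rfl, h, fun i _ a m hm => ?_, fun i _ => hle i, fun i _ a m hm =>
    (mem_upperFiltration_succ ρ i m).1 hm a⟩
  have := (mem_upperFiltration_succ ρ i m).1 (hle i hm) a
  simpa using add_mem this hm

lemma nilpotent_of_hasNilpotentFiltration {ρ : Representation ℤ A M} {r : ℕ}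
    (h : HasNilpotentFiltration ρ r) : IsNilpotentModule ρ ∧ filtrationLength ρ ≤ r :=
  ⟨⟨r, h⟩, Nat.sInf_le h⟩

end Filtration

/-! ### Comparison with the singular homology of Mathlib -/

section Comparison

open AlgebraicTopology Limits SSet Simplicial

/-- The coefficients. -/
abbrev coeffZ : ModuleCat.{u} ℤ := ModuleCat.of ℤ (ULift.{u} ℤ)

/-- The singular chain complex with integral coefficients. -/
abbrev mathlibChains (X : Type u) [TopologicalSpace X] : ChainComplex (ModuleCat.{u} ℤ) ℕ :=
  (TopCat.toSSet.obj (TopCat.of X)).chainComplex coeffZ.{u}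

variable {X Y : Type u} [TopologicalSpace X] [TopologicalSpace Y]

/-- Singular simplices as continuous maps. -/
def simplexEquiv (X : Type u) [TopologicalSpace X] (n : ℕ) :
    (TopCat.toSSet.obj (TopCat.of X)) _⦋n⦌ ≃ C(stdSimplex ℝ (Fin (n + 1)), X) :=
  (TopCat.of X).toSSetObjEquiv (.op ⦋n⦌)

lemma simplexEquiv_δ (n : ℕ) (x : (TopCat.toSSet.obj (TopCat.of X)) _⦋n + 1⦌) (i : Fin (n + 2)) :
    simplexEquiv X n ((TopCat.toSSet.obj (TopCat.of X)).δ i x) =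
      (simplexEquiv X (n + 1) x).comp (faceIncl (n + 1) i) :=
  ContinuousMap.ext fun t => TopCat.toSSetObjEquiv_δ_apply x i t

lemma simplexEquiv_map (f : C(X, Y)) (n : ℕ) (x : (TopCat.toSSet.obj (TopCat.of X)) _⦋n⦌) :
    simplexEquiv Y n ((TopCat.toSSet.map (TopCat.ofHom f)).app _ x) =
      f.comp (simplexEquiv X n x) := rfl

/-- The generator of the singular chains of Mathlib given by a simplex. -/
def chainGen {n : ℕ} (x : (TopCat.toSSet.obj (TopCat.of X)) _⦋n⦌) : (mathlibChains X).X n :=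
  ((TopCat.toSSet.obj (TopCat.of X)).ιChainComplex (R := coeffZ.{u}) x).hom (⟨1⟩ : ULift ℤ)

/-- The chains are a coproduct of copies of `ULift ℤ` indexed by simplices, and a homomorphism on
each copy is determined by the image of 1. -/
lemma mathlibChains_hom_ext {n : ℕ} {T : Type u} [AddCommGroup T] [Module ℤ T]
    {f g : (mathlibChains X).X n →ₗ[ℤ] T} (h : ∀ x, f (chainGen x) = g (chainGen x)) : f = g := by
  have h1 : ∀ φ ψ : ULift.{u} ℤ →ₗ[ℤ] T, φ ⟨1⟩ = ψ ⟨1⟩ → φ = ψ := by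
    intro φ ψ hφ
    ext ⟨k⟩
    have : (⟨k⟩ : ULift.{u} ℤ) = k • (⟨1⟩ : ULift.{u} ℤ) := by
      ext
      simp
    rw [this, map_zsmul, map_zsmul, hφ]
  suffices ModuleCat.ofHom f = ModuleCat.ofHom g from congrArg ModuleCat.Hom.hom this
  refine chainComplex_hom_ext fun x => ?_
  ext1
  exact h1 (ModuleCat.Hom.hom (ιChainComplex _ x ≫ ModuleCat.ofHom f))
    (ModuleCat.Hom.hom (ιChainComplex _ x ≫ ModuleCat.ofHom g)) (h x)

lemma d_chainGen (n : ℕ) (x : (TopCat.toSSet.obj (TopCat.of X)) _⦋n + 1⦌) :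
    ((mathlibChains X).d (n + 1) n).hom (chainGen x) =
      ∑ i : Fin (n + 2), (-1 : ℤ) ^ (i : ℕ) •
        chainGen ((TopCat.toSSet.obj (TopCat.of X)).δ i x) := by
  have h := congrArg (fun f => f.hom (⟨1⟩ : ULift ℤ))
    (ιChainComplex_d (TopCat.toSSet.obj (TopCat.of X)) coeffZ.{u} x)
  refine h.trans ?_
  simp only [ModuleCat.hom_sum, LinearMap.sum_apply]
  rfl

lemma map_chainGen (f : C(X, Y)) (n : ℕ) (x : (TopCat.toSSet.obj (TopCat.of X)) _⦋n⦌) :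
    ((chainComplexMap (TopCat.toSSet.map (TopCat.ofHom f)) coeffZ).f n).hom (chainGen x) =
      chainGen ((TopCat.toSSet.map (TopCat.ofHom f)).app _ x) :=
  congrArg (fun f => f.hom (⟨1⟩ : ULift ℤ))
    (ι_chainComplexMap_f (TopCat.toSSet.obj (TopCat.of X)) (TopCat.toSSet.obj (TopCat.of Y))
      (TopCat.toSSet.map (TopCat.ofHom f)) coeffZ.{u} x)

/-- The cofan of explicit chains. -/
def singChainCofan (X : Type u) [TopologicalSpace X] (n : ℕ) :
    Cofan (fun _ : (TopCat.toSSet.obj (TopCat.of X)) _⦋n⦌ => coeffZ.{u}) :=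
  Cofan.mk (ModuleCat.of ℤ (SingChain X (n + 1))) fun x => ModuleCat.ofHom
    ((Finsupp.lsingle (simplexEquiv X n x)) ∘ₗ
      (ULift.moduleEquiv : ULift.{u} ℤ ≃ₗ[ℤ] ℤ).toLinearMap)

/-- The comparison map from the singular chains of Mathlib to explicit chains. -/
def toSingChain (X : Type u) [TopologicalSpace X] (n : ℕ) :
    (mathlibChains X).X n →ₗ[ℤ] SingChain X (n + 1) :=
  (((TopCat.toSSet.obj (TopCat.of X)).isColimitChainComplexXCofan coeffZ n).desc
    (singChainCofan X n)).hom

lemma toSingChain_gen (n : ℕ) (x : (TopCat.toSSet.obj (TopCat.of X)) _⦋n⦌) :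
    toSingChain X n (chainGen x) = Finsupp.single (simplexEquiv X n x) 1 := by
  have h := ((TopCat.toSSet.obj (TopCat.of X)).isColimitChainComplexXCofan coeffZ n).fac
    (singChainCofan X n) ⟨x⟩
  exact congrArg (fun f => f.hom (⟨1⟩ : ULift ℤ)) h

/-- The inverse of the comparison map. -/
def ofSingChain (X : Type u) [TopologicalSpace X] (n : ℕ) :
    SingChain X (n + 1) →ₗ[ℤ] (mathlibChains X).X n :=
  Finsupp.linearCombination ℤ fun α => chainGen ((simplexEquiv X n).symm α)

lemma ofSingChain_single (n : ℕ) (α : C(stdSimplex ℝ (Fin (n + 1)), X)) :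
    ofSingChain X n (.single α 1) = chainGen ((simplexEquiv X n).symm α) := by
  rw [ofSingChain, Finsupp.linearCombination_single]
  exact @one_smul ℤ _ _ ((mathlibChains X).X n).isModule.toMulAction _

lemma ofSingChain_toSingChain (n : ℕ) (c : (mathlibChains X).X n) :
    ofSingChain X n (toSingChain X n c) = c := by
  have : ofSingChain X n ∘ₗ toSingChain X n = LinearMap.id := by
    refine mathlibChains_hom_ext fun x => ?_
    rw [LinearMap.comp_apply, toSingChain_gen, ofSingChain_single, Equiv.symm_apply_apply]
    rfl
  exact DFunLike.congr_fun this c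

lemma toSingChain_ofSingChain (n : ℕ) (c : SingChain X (n + 1)) :
    toSingChain X n (ofSingChain X n c) = c := by
  suffices toSingChain X n ∘ₗ ofSingChain X n = LinearMap.id from DFunLike.congr_fun this c
  refine Finsupp.lhom_ext' fun α => LinearMap.ext_ring ?_
  simp only [LinearMap.comp_apply, Finsupp.lsingle_apply, ofSingChain_single, LinearMap.id_apply,
    toSingChain_gen, Equiv.apply_symm_apply]

lemma bdry_toSingChain (n : ℕ) (c : (mathlibChains X).X (n + 1)) :
    SingChain.bdry X (n + 1) (toSingChain X (n + 1) c) =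
      toSingChain X n (((mathlibChains X).d (n + 1) n).hom c) := by
  have : SingChain.bdry X (n + 1) ∘ₗ toSingChain X (n + 1) =
      toSingChain X n ∘ₗ ((mathlibChains X).d (n + 1) n).hom := by
    refine mathlibChains_hom_ext fun x => ?_
    simp only [LinearMap.comp_apply, toSingChain_gen, d_chainGen, map_sum, map_zsmul,
      simplexEquiv_δ, SingChain.bdry_single]
  exact DFunLike.congr_fun this c

lemma push_toSingChain (f : C(X, Y)) (n : ℕ) (c : (mathlibChains X).X n) :
    SingChain.push f (n + 1) (toSingChain X n c) = toSingChain Y n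
      (((chainComplexMap (TopCat.toSSet.map (TopCat.ofHom f)) coeffZ).f n).hom c) := by
  have : SingChain.push f (n + 1) ∘ₗ toSingChain X n = toSingChain Y n ∘ₗ
      ((chainComplexMap (TopCat.toSSet.map (TopCat.ofHom f)) coeffZ).f n).hom := by
    refine mathlibChains_hom_ext fun x => ?_
    simp only [LinearMap.comp_apply, toSingChain_gen, map_chainGen, simplexEquiv_map,
      SingChain.push_single]
  exact DFunLike.congr_fun this c

/-- The class of a cycle in the singular homology of Mathlib. -/
def homologyClass (X : Type u) [TopologicalSpace X] (n : ℕ) :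
    (mathlibChains X).cycles n →ₗ[ℤ] (singularHomologyZ.{u} n).obj (TopCat.of X) :=
  ((mathlibChains X).homologyπ n).hom

lemma homologyClass_surjective (n : ℕ) : Function.Surjective (homologyClass X n) :=
  (ModuleCat.epi_iff_surjective ((mathlibChains X).homologyπ n)).1 inferInstance

lemma homologyClass_eq_zero (n : ℕ) (c : (mathlibChains X).cycles n) {w : SingChain X (n + 2)}
    (hw : SingChain.bdry X (n + 1) w = toSingChain X n (((mathlibChains X).iCycles n).hom c)) :
    homologyClass X n c = 0 := by
  have h1 : ((mathlibChains X).iCycles n).hom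
      (((mathlibChains X).toCycles (n + 1) n).hom (ofSingChain X (n + 1) w)) =
        ((mathlibChains X).iCycles n).hom c := by
    rw [← LinearMap.comp_apply, ← ModuleCat.hom_comp, HomologicalComplex.toCycles_i,
      ← ofSingChain_toSingChain n (((mathlibChains X).d (n + 1) n).hom _), ← bdry_toSingChain,
      toSingChain_ofSingChain, hw, ofSingChain_toSingChain]
  have h2 := (ModuleCat.mono_iff_injective ((mathlibChains X).iCycles n)).1 inferInstance h1
  rw [← h2]
  exact congrArg (fun f => f.hom (ofSingChain X (n + 1) w))
    ((mathlibChains X).toCycles_comp_homologyπ (n + 1) n)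

lemma isCycle_toSingChain (n : ℕ) (c : (mathlibChains X).cycles n) :
    SingChain.IsCycle n (toSingChain X n (((mathlibChains X).iCycles n).hom c)) := by
  cases n with
  | zero => trivial
  | succ n =>
    change SingChain.bdry X (n + 1) _ = 0
    rw [bdry_toSingChain, ← LinearMap.comp_apply ((mathlibChains X).d (n + 1) n).hom,
      ← ModuleCat.hom_comp, HomologicalComplex.iCycles_d]
    simp

/-- If all cycles are killed by iterated differences, then the homology is nilpotent. -/
lemma hasNilpotentFiltration_of_kill {G : Type v} [Group G] (A : Subgroup G) (E : Type u)
    [TopologicalSpace E] [MulAction G E] [ContinuousConstSMul G E] (n r : ℕ)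
    (h : ∀ z : SingChain E (n + 1), SingChain.IsCycle n z → SingChain.Kill
      (fun a : A => (⟨fun x => (a : G) • x, continuous_const_smul (a : G)⟩ : C(E, E))) univ n r z) :
    HasNilpotentFiltration (subgroupHomologyRep A E n) r := by
  refine hasNilpotentFiltration_of_upperFiltration _ _ ?_
  rw [eq_top_iff]
  intro m _
  obtain ⟨c, rfl⟩ := homologyClass_surjective n m
  have hc := h _ (isCycle_toSingChain n c)
  clear h
  induction r generalizing c with
  | zero =>
    obtain ⟨w, -, hw⟩ := hc
    exact homologyClass_eq_zero n c hw
  | succ r ih =>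
    rw [mem_upperFiltration_succ]
    intro a
    let f : C(E, E) := ⟨fun x => (a : G) • x, continuous_const_smul (a : G)⟩
    let F := chainComplexMap (TopCat.toSSet.map (TopCat.ofHom f)) coeffZ.{u}
    have h1 : subgroupHomologyRep A E n a (homologyClass E n c) =
        homologyClass E n ((HomologicalComplex.cyclesMap F n).hom c) :=
      congrArg (fun f => f.hom c) (HomologicalComplex.homologyπ_naturality F n)
    have h2 : ((mathlibChains E).iCycles n).hom ((HomologicalComplex.cyclesMap F n).hom c) =
        (F.f n).hom (((mathlibChains E).iCycles n).hom c) :=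
      congrArg (fun f => f.hom c) (HomologicalComplex.cyclesMap_i F n)
    -- The difference ρ(a) m - m is the class of the chain-level difference of a representing cycle,
    -- so the induction can continue with that cycle.
    rw [h1, ← map_sub]
    refine ih _ trivial ?_
    rw [map_sub, map_sub, h2, ← push_toSingChain]
    exact hc a

end Comparison
end

noncomputable section

/-! ### Skeleta of CW-complexes -/

section CW

open Topology.RelCWComplex Metric

variable {B : Type u} [TopologicalSpace B] [T2Space B] [CWComplex (univ : Set B)]

/-- The union of the cells of dimension less than `k`. -/
def cwSkel (B : Type u) [TopologicalSpace B] [T2Space B] [CWComplex (univ : Set B)] (k : ℕ) :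
    Set B :=
  skeletonLT (univ : Set B) (k : ℕ∞)

lemma mem_cwSkel_iff {k : ℕ} {b : B} :
    b ∈ cwSkel B k ↔ ∃ (m : ℕ) (_ : m < k) (e : cell (univ : Set B) m), b ∈ openCell m e := by
  rw [cwSkel]
  refine Iff.trans (CWComplex.mem_skeletonLT_iff (C := (univ : Set B))) ?_
  simp only [Nat.cast_lt]

lemma isClosed_cwSkel (k : ℕ) : IsClosed (cwSkel B k) := Subcomplex.closed _

lemma cwSkel_zero : cwSkel B 0 = ∅ := by
  ext b
  simp [mem_cwSkel_iff]

lemma cwSkel_mono {k l : ℕ} (h : k ≤ l) : cwSkel B k ⊆ cwSkel B l := fun b hb => by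
  obtain ⟨m, hm, e, he⟩ := mem_cwSkel_iff.1 hb
  exact mem_cwSkel_iff.2 ⟨m, hm.trans_le h, e, he⟩

lemma exists_mem_openCell (b : B) : ∃ (m : ℕ) (e : cell (univ : Set B) m), b ∈ openCell m e := by
  have h : b ∈ (univ : Set B) := mem_univ b
  rw [← CWComplex.iUnion_openCell_eq_complex (C := (univ : Set B))] at h
  simpa using h

/-- The index of `cwSkel` bounds dimensions strictly, so d + 1 stages exhaust a d-dimensional
complex. This is the source of the bound d + 1. -/
lemma cwSkel_eq_univ {d : ℕ} (hd : cwDim (univ : Set B) = d) : cwSkel B (d + 1) = univ := by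
  refine eq_univ_of_forall fun b => ?_
  obtain ⟨m, e, he⟩ := exists_mem_openCell b
  refine mem_cwSkel_iff.2 ⟨m, ?_, e, he⟩
  have h : (m : ℕ∞) ≤ cwDim (univ : Set B) :=
    le_iSup₂ (f := fun (n : ℕ) (_ : Nonempty (cell (univ : Set B) n)) => (n : ℕ∞)) m ⟨e⟩
  rw [hd, Nat.cast_le] at h
  omega

lemma closedCell_subset_cwSkel {k m : ℕ} (h : m < k) (e : cell (univ : Set B) m) :
    closedCell m e ⊆ cwSkel B k :=
  (closedCell_subset_skeletonLT m e).trans (SetLike.coe_subset_coe.2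
    (skeletonLT_mono (by exact_mod_cast h)))

lemma cellFrontier_subset_cwSkel {m : ℕ} (e : cell (univ : Set B) m) :
    cellFrontier m e ⊆ cwSkel B m :=
  cellFrontier_subset_skeletonLT m e

lemma disjoint_cwSkel_openCell {k m : ℕ} (h : k ≤ m) (e : cell (univ : Set B) m) :
    Disjoint (cwSkel B k) (openCell m e) :=
  disjoint_skeletonLT_openCell (by exact_mod_cast h)

lemma openCell_eq_of_mem {k : ℕ} {e e' : cell (univ : Set B) k} {b : B} (h : b ∈ openCell k e)
    (h' : b ∈ openCell k e') : e = e' := by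
  have := eq_of_not_disjoint_openCell (Set.not_disjoint_iff.2 ⟨b, h, h'⟩)
  simpa using this

/-- A set inside `cwSkel B k` misses all open cells of dimension at least k, so only lower cells
have to be tested. -/
lemma isClosed_of_cwSkel {k : ℕ} {A : Set B} (hA : A ⊆ cwSkel B k)
    (h : ∀ m < k, ∀ e : cell (univ : Set B) m,
      Disjoint A (openCell m e) ∨ IsClosed (A ∩ closedCell m e)) : IsClosed A := by
  refine CWComplex.isClosed_of_disjoint_openCell_or_isClosed_inter_closedCell
    (C := (univ : Set B)) (subset_univ _) fun m _ e => ?_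
  by_cases hm : m < k
  · exact h m hm e
  · exact Or.inl ((disjoint_cwSkel_openCell (not_lt.1 hm) e).mono_left hA)

lemma continuousOn_cwSkel {Z : Type*} [TopologicalSpace Z] {k : ℕ} {g : B → Z}
    (h : ∀ m < k, ∀ e : cell (univ : Set B) m, ContinuousOn (g ∘ map m e) (closedBall 0 1)) :
    ContinuousOn g (cwSkel B k) := by
  rw [continuousOn_iff_isClosed]
  intro t ht
  refine ⟨g ⁻¹' t ∩ cwSkel B k, ?_, by rw [inter_assoc, inter_self]⟩
  refine isClosed_of_cwSkel inter_subset_right fun m hm e => Or.inr ?_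
  have h1 : g ⁻¹' t ∩ cwSkel B k ∩ closedCell m e =
      map m e '' (closedBall 0 1 ∩ (g ∘ map m e) ⁻¹' t) := by
    ext b
    constructor
    · rintro ⟨⟨hb, -⟩, x, hx, rfl⟩
      exact ⟨x, ⟨hx, hb⟩, rfl⟩
    · rintro ⟨x, ⟨hx, hb⟩, rfl⟩
      exact ⟨⟨hb, closedCell_subset_cwSkel hm e ⟨x, hx, rfl⟩⟩, x, hx, rfl⟩
  rw [h1]
  have h2 : IsCompact (closedBall (0 : Fin m → ℝ) 1 ∩ (g ∘ map m e) ⁻¹' t) :=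
    (isCompact_closedBall 0 1).of_isClosed_subset
      ((h m hm e).preimage_isClosed_of_isClosed isClosed_closedBall ht) inter_subset_left
  exact (h2.image_of_continuousOn ((continuousOn m e).mono inter_subset_left)).isClosed

/-- Since r < 1, the balls stay inside open k-cells. The union therefore misses the closed cells of
lower dimension and meets each closed k-cell in one compact ball. -/
lemma isClosed_iUnion_cellBall (k : ℕ) {r : ℝ} (hr : r < 1) :
    IsClosed (⋃ e : cell (univ : Set B) k, map k e '' closedBall 0 r) := by
  have hsub : ∀ e : cell (univ : Set B) k, map k e '' closedBall 0 r ⊆ openCell k e := fun e =>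
    image_mono (closedBall_subset_ball hr)
  refine isClosed_of_cwSkel (k := k + 1) ?_ fun m hm e => ?_
  · refine iUnion_subset fun e => (hsub e).trans ?_
    exact (openCell_subset_closedCell k e).trans (closedCell_subset_cwSkel k.lt_succ_self e)
  · rcases (Nat.lt_succ_iff.1 hm).lt_or_eq with hm | rfl
    · left
      rw [disjoint_iUnion_left]
      intro e'
      refine Disjoint.symm ((disjoint_cwSkel_openCell le_rfl e').mono ?_ (hsub e'))
      exact (openCell_subset_closedCell m e).trans (closedCell_subset_cwSkel hm e)
    · right
      have : (⋃ e : cell (univ : Set B) m, map m e '' closedBall 0 r) ∩ closedCell m e =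
          map m e '' closedBall 0 r := by
        ext b
        constructor
        · rintro ⟨hb, hbe⟩
          obtain ⟨e', he'⟩ := mem_iUnion.1 hb
          rw [← cellFrontier_union_openCell_eq_closedCell] at hbe
          rcases hbe with hbe | hbe
          · exact ((disjoint_cwSkel_openCell le_rfl e').notMem_of_mem_left
              (cellFrontier_subset_cwSkel e hbe) (hsub e' he')).elim
          · rwa [openCell_eq_of_mem hbe (hsub e' he')]
        · exact fun hb => ⟨mem_iUnion.2 ⟨e, hb⟩, openCell_subset_closedCell m e (hsub e hb)⟩
      rw [this]
      exact ((isCompact_closedBall 0 r).image_of_continuousOn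
        ((continuousOn m e).mono (closedBall_subset_closedBall hr.le))).isClosed

/-- Among the cells of dimension at most k, every closed cell except that of e is disjoint from the
open cell of e, so the complement is closed. -/
lemma openCell_mem_nhdsWithin {k : ℕ} {e : cell (univ : Set B) k} {b : B} (hb : b ∈ openCell k e) :
    openCell k e ∈ 𝓝[cwSkel B (k + 1)] b := by
  have hcl : IsClosed (cwSkel B (k + 1) \ openCell k e) := by
    refine isClosed_of_cwSkel sdiff_subset fun m hm e' => ?_
    by_cases h : (⟨m, e'⟩ : Σ n, cell (univ : Set B) n) = ⟨k, e⟩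
    · obtain ⟨rfl, h⟩ := Sigma.mk.inj_iff.1 h
      obtain rfl := eq_of_heq h
      exact Or.inl disjoint_sdiff_left
    · right
      have h1 : Disjoint (closedCell m e') (openCell k e) := by
        rw [← cellFrontier_union_openCell_eq_closedCell, disjoint_union_left]
        refine ⟨(disjoint_cwSkel_openCell (Nat.lt_succ_iff.1 hm) e).mono_left
          (cellFrontier_subset_cwSkel e'), disjoint_openCell_of_ne h⟩
      have h2 : cwSkel B (k + 1) \ openCell k e ∩ closedCell m e' = closedCell m e' :=
        inter_eq_right.2 fun x hx => ⟨closedCell_subset_cwSkel hm e' hx, h1.notMem_of_mem_left hx⟩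
      rw [h2]
      exact isClosed_closedCell
  rw [mem_nhdsWithin]
  refine ⟨_, hcl.isOpen_compl, fun h => h.2 hb, ?_⟩
  rintro x ⟨hx, hx'⟩
  by_contra hxe
  exact hx ⟨hx', hxe⟩

lemma mem_cwSkel_succ_iff {k : ℕ} {b : B} :
    b ∈ cwSkel B (k + 1) ↔ b ∈ cwSkel B k ∨ ∃ e : cell (univ : Set B) k, b ∈ openCell k e := by
  constructor
  · intro hb
    obtain ⟨m, hm, e, he⟩ := mem_cwSkel_iff.1 hb
    rcases (Nat.lt_succ_iff.1 hm).lt_or_eq with hm | rfl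
    · exact Or.inl (mem_cwSkel_iff.2 ⟨m, hm, e, he⟩)
    · exact Or.inr ⟨e, he⟩
  · rintro (hb | ⟨e, he⟩)
    · exact cwSkel_mono k.le_succ hb
    · exact mem_cwSkel_iff.2 ⟨k, k.lt_succ_self, e, he⟩

/-! ### Radial deformations -/

/-- The radial expansion of the unit ball. -/
def radialExpand {k : ℕ} (x : Fin k → ℝ) (t : I) : Fin k → ℝ :=
  (max ‖x‖ (1 + (t : ℝ))⁻¹)⁻¹ • x

lemma radialExpand_pos {k : ℕ} (x : Fin k → ℝ) (t : I) : 0 < max ‖x‖ (1 + (t : ℝ))⁻¹ :=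
  lt_max_of_lt_right (inv_pos.2 (by linarith [t.2.1]))

lemma continuous_radialExpand {k : ℕ} :
    Continuous fun z : (Fin k → ℝ) × I => radialExpand z.1 z.2 := by
  have hc : Continuous fun z : (Fin k → ℝ) × I => max ‖z.1‖ (1 + (z.2 : ℝ))⁻¹ := by
    refine (continuous_norm.comp continuous_fst).max (Continuous.inv₀ (by fun_prop) fun z => ?_)
    have := z.2.2.1
    positivity
  exact (hc.inv₀ fun z => (radialExpand_pos z.1 z.2).ne').smul continuous_fst

lemma norm_radialExpand_le {k : ℕ} (x : Fin k → ℝ) (t : I) : ‖radialExpand x t‖ ≤ 1 := by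
  have h := radialExpand_pos x t
  rw [radialExpand, norm_smul, norm_inv, Real.norm_of_nonneg h.le, inv_mul_le_one₀ h]
  exact le_max_left _ _

lemma radialExpand_zero {k : ℕ} {x : Fin k → ℝ} (hx : ‖x‖ ≤ 1) : radialExpand x 0 = x := by
  simp [radialExpand, hx]

/-- Boundary points never move; so the expansions of different cells agree with the constant paths
on the lower skeleton. -/
lemma radialExpand_of_norm_eq_one {k : ℕ} {x : Fin k → ℝ} (hx : ‖x‖ = 1) (t : I) :
    radialExpand x t = x := by
  rw [radialExpand, hx, max_eq_left, inv_one, one_smul]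
  exact inv_le_one_of_one_le₀ (by linarith [t.2.1])

lemma norm_radialExpand_one {k : ℕ} {x : Fin k → ℝ} (hx : 1 / 2 ≤ ‖x‖) :
    ‖radialExpand x 1‖ = 1 := by
  have h := radialExpand_pos x 1
  rw [radialExpand, norm_smul, norm_inv, Real.norm_of_nonneg h.le]
  have : max ‖x‖ (1 + ((1 : I) : ℝ))⁻¹ = ‖x‖ := max_eq_left (by norm_num; linarith)
  rw [this]
  exact inv_mul_cancel₀ (by linarith)

/-- The family of paths in a closed cell obtained from the radial expansion. -/
def cellExpand {k : ℕ} (e : cell (univ : Set B) k) : C(Fin k → ℝ, C(I, B)) :=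
  ContinuousMap.curry ⟨fun z => map k e (radialExpand z.1 z.2),
    (continuousOn k e).comp_continuous continuous_radialExpand fun _ =>
      mem_closedBall_zero_iff.2 (norm_radialExpand_le _ _)⟩

open Classical in
/-- The radial expansion of all `k`-cells. -/
def skelExpand (B : Type u) [TopologicalSpace B] [T2Space B] [CWComplex (univ : Set B)] (k : ℕ)
    (b : B) : C(I, B) :=
  if h : ∃ e : cell (univ : Set B) k, b ∈ openCell k e then
    cellExpand h.choose ((map k h.choose).symm b) else ContinuousMap.const I b

lemma map_symm_map {k : ℕ} (e : cell (univ : Set B) k) {x : Fin k → ℝ} (hx : x ∈ ball 0 1) :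
    (map k e).symm (map k e x) = x :=
  (map k e).left_inv (by rwa [source_eq])

lemma skelExpand_of_mem_openCell {k : ℕ} {e : cell (univ : Set B) k} {x : Fin k → ℝ}
    (hx : x ∈ ball 0 1) : skelExpand B k (map k e x) = cellExpand e x := by
  have h : ∃ e : cell (univ : Set B) k, map k e x ∈ openCell k e := ⟨e, x, hx, rfl⟩
  have h' : ∃ e' : cell (univ : Set B) k, map k e x ∈ openCell k e' := ⟨e, x, hx, rfl⟩
  have he : h'.choose = e := openCell_eq_of_mem h'.choose_spec ⟨x, hx, rfl⟩
  rw [skelExpand, dif_pos h', he, map_symm_map e hx]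

lemma skelExpand_of_mem_cwSkel {k : ℕ} {b : B} (hb : b ∈ cwSkel B k) :
    skelExpand B k b = ContinuousMap.const I b := by
  rw [skelExpand, dif_neg]
  rintro ⟨e, he⟩
  exact (disjoint_cwSkel_openCell le_rfl e).notMem_of_mem_left hb he

lemma skelExpand_map {k : ℕ} (e : cell (univ : Set B) k) {x : Fin k → ℝ}
    (hx : x ∈ closedBall 0 1) : skelExpand B k (map k e x) = cellExpand e x := by
  rcases (mem_closedBall_zero_iff.1 hx).lt_or_eq with h | h
  · exact skelExpand_of_mem_openCell (mem_ball_zero_iff.2 h)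
  · rw [skelExpand_of_mem_cwSkel
      (cellFrontier_subset_cwSkel e ⟨x, mem_sphere_zero_iff_norm.2 h, rfl⟩)]
    ext t
    change _ = map k e (radialExpand x t)
    rw [radialExpand_of_norm_eq_one h]
    rfl

/-- The deformation is treated as a map into the path space. Continuity can then be tested cell by
cell, without a cell structure on the product with the interval. -/
lemma continuousOn_skelExpand (k : ℕ) : ContinuousOn (skelExpand B k) (cwSkel B (k + 1)) := by
  refine continuousOn_cwSkel fun m hm e => ?_
  rcases (Nat.lt_succ_iff.1 hm).lt_or_eq with hm | rfl
  · refine ContinuousOn.congr (f := fun x => ContinuousMap.const I (map m e x)) ?_ fun x hx =>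
      skelExpand_of_mem_cwSkel (closedCell_subset_cwSkel hm e ⟨x, hx, rfl⟩)
    exact ContinuousMap.continuous_const'.comp_continuousOn (continuousOn m e)
  · exact (cellExpand e).continuous.continuousOn.congr fun x hx => skelExpand_map e hx

/-- The cells of dimension `k` deform into the lower skeleton away from their centres. -/
lemma exists_skeleton_deformation (k : ℕ) : ∃ (U : Set B) (Φ : C(cwSkel B (k + 1), C(I, B))),
    IsOpen U ∧ cwSkel B k ⊆ U ∧ (∀ b, Φ b 0 = b) ∧ (∀ b t, Φ b t ∈ cwSkel B (k + 1)) ∧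
      ∀ b : cwSkel B (k + 1), (b : B) ∈ U → Φ b 1 ∈ cwSkel B k := by
  -- The radius 1/2 is the value of 1 / (1 + t) at t = 1: exactly the points of norm at least 1/2
  -- have been pushed to the sphere at the end.
  refine ⟨(⋃ e : cell (univ : Set B) k, map k e '' closedBall 0 (1 / 2))ᶜ,
    ⟨fun b => skelExpand B k b, (continuousOn_skelExpand k).domRestrict⟩,
    (isClosed_iUnion_cellBall k (by norm_num)).isOpen_compl, ?_, ?_, ?_, ?_⟩
  · intro b hb h
    obtain ⟨e, x, hx, rfl⟩ := mem_iUnion.1 h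
    exact (disjoint_cwSkel_openCell le_rfl e).notMem_of_mem_left hb
      ⟨x, closedBall_subset_ball (by norm_num) hx, rfl⟩
  · rintro ⟨b, hb⟩
    change skelExpand B k b 0 = b
    rcases mem_cwSkel_succ_iff.1 hb with h | ⟨e, x, hx, rfl⟩
    · rw [skelExpand_of_mem_cwSkel h]
      rfl
    · rw [skelExpand_of_mem_openCell hx]
      change map k e (radialExpand x 0) = _
      rw [radialExpand_zero (mem_ball_zero_iff.1 hx).le]
  · rintro ⟨b, hb⟩ t
    change skelExpand B k b t ∈ _
    rcases mem_cwSkel_succ_iff.1 hb with h | ⟨e, x, hx, rfl⟩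
    · rw [skelExpand_of_mem_cwSkel h]
      exact hb
    · rw [skelExpand_of_mem_openCell hx]
      exact closedCell_subset_cwSkel k.lt_succ_self e
        ⟨_, mem_closedBall_zero_iff.2 (norm_radialExpand_le _ _), rfl⟩
  · rintro ⟨b, hb⟩ hU
    change skelExpand B k b 1 ∈ _
    rcases mem_cwSkel_succ_iff.1 hb with h | ⟨e, x, hx, rfl⟩
    · rw [skelExpand_of_mem_cwSkel h]
      exact h
    · rw [skelExpand_of_mem_openCell hx]
      refine cellFrontier_subset_cwSkel e ⟨_, mem_sphere_zero_iff_norm.2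
        (norm_radialExpand_one (x := x) ?_), rfl⟩
      by_contra hlt
      exact hU (mem_iUnion.2 ⟨e, x, mem_closedBall_zero_iff.2 (not_le.1 hlt).le, rfl⟩)

/-- The contraction of an open cell to its centre, followed by a path. -/
lemma exists_openCell_contraction {k : ℕ} (e : cell (univ : Set B) k) {b₀ : B}
    (γ : Path (map k e 0) b₀) : ∃ Ψ : C(openCell k e, C(I, B)), ∀ b, Ψ b 0 = b ∧ Ψ b 1 = b₀ := by
  have hs : ∀ b : openCell k e, (map k e).symm b ∈ ball (0 : Fin k → ℝ) 1 := by
    rintro ⟨_, x, hx, rfl⟩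
    rwa [map_symm_map e hx]
  have hc : Continuous fun b : openCell k e => (map k e).symm b := by
    refine (continuousOn_symm k e).comp_continuous continuous_subtype_val fun b => ?_
    rw [← (map k e).image_source_eq_target, source_eq]
    exact b.2
  let H₁ : ContinuousMap.Homotopy (⟨Subtype.val, continuous_subtype_val⟩ : C(openCell k e, B))
      (ContinuousMap.const _ (map k e 0)) :=
    { toFun := fun z => map k e ((1 - (z.1 : ℝ)) • (map k e).symm z.2)
      continuous_toFun := by
        refine (continuousOn k e).comp_continuous ?_ fun z => ?_
        · exact (continuous_const.sub (continuous_subtype_val.comp continuous_fst)).smul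
            (hc.comp continuous_snd)
        · rw [mem_closedBall_zero_iff, norm_smul, Real.norm_of_nonneg (by linarith [z.1.2.2])]
          exact mul_le_one₀ (by linarith [z.1.2.1]) (norm_nonneg _)
            (mem_ball_zero_iff.1 (hs z.2)).le
      map_zero_left := by
        rintro ⟨_, x, hx, rfl⟩
        simp [map_symm_map e hx]
      map_one_left := fun b => by simp }
  let H₂ : ContinuousMap.Homotopy (ContinuousMap.const (openCell k e) (map k e 0))
      (ContinuousMap.const _ b₀) :=
    { toFun := fun z => γ z.1
      continuous_toFun := by fun_prop
      map_zero_left := fun b => by simp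
      map_one_left := fun b => by simp }
  refine ⟨ContinuousMap.curry ((H₁.trans H₂).toContinuousMap.comp ContinuousMap.prodSwap),
    fun b => ⟨?_, ?_⟩⟩
  · exact (H₁.trans H₂).apply_zero b
  · exact (H₁.trans H₂).apply_one b

/-- The union of the open `k`-cells contracts in a path connected complex. -/
lemma exists_openCells_contraction [PathConnectedSpace B] (k : ℕ) (b₀ : B) :
    ∃ Ψ : C(↥(cwSkel B (k + 1) ∩ (cwSkel B k)ᶜ), C(I, B)), ∀ b, Ψ b 0 = b ∧ Ψ b 1 = b₀ := by
  have h := fun e : cell (univ : Set B) k =>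
    exists_openCell_contraction e (PathConnectedSpace.somePath (map k e 0) b₀)
  choose Ψ hΨ using h
  have hcell : ∀ b : ↥(cwSkel B (k + 1) ∩ (cwSkel B k)ᶜ), ∃ e : cell (univ : Set B) k,
      (b : B) ∈ openCell k e := fun b => (mem_cwSkel_succ_iff.1 b.2.1).resolve_left b.2.2
  choose ε hε using hcell
  refine ⟨⟨fun b => Ψ (ε b) ⟨b, hε b⟩, ?_⟩, fun b => hΨ (ε b) ⟨b, hε b⟩⟩
  rw [continuous_iff_continuousAt]
  intro b
  have hnhds : {b' : ↥(cwSkel B (k + 1) ∩ (cwSkel B k)ᶜ) | (b' : B) ∈ openCell k (ε b)} ∈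
      𝓝 b := by
    have h1 := nhdsWithin_mono (b : B) (inter_subset_left (s := cwSkel B (k + 1))
      (t := (cwSkel B k)ᶜ)) (openCell_mem_nhdsWithin (hε b))
    rw [nhdsWithin_eq_map_subtype_coe b.2] at h1
    exact h1
  -- Each open k-cell is open in this difference of skeleta, and the chosen cell ε is constant on
  -- it, so locally a single contraction is used.
  have hon : ContinuousOn (fun b' : ↥(cwSkel B (k + 1) ∩ (cwSkel B k)ᶜ) =>
      Ψ (ε b') ⟨b', hε b'⟩) {b' | (b' : B) ∈ openCell k (ε b)} := by
    rw [continuousOn_iff_continuous_domRestrict]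
    have : ({b' | (b' : B) ∈ openCell k (ε b)} : Set ↥(cwSkel B (k + 1) ∩ (cwSkel B k)ᶜ)).domRestrict
        (fun b' => Ψ (ε b') ⟨b', hε b'⟩) = fun b' => Ψ (ε b) ⟨b'.1.1, b'.2⟩ := by
      funext b'
      have he : ∀ e (_ : e = ε b) (h : (b'.1 : B) ∈ openCell k e),
          Ψ e ⟨b'.1, h⟩ = Ψ (ε b) ⟨b'.1, b'.2⟩ := by
        rintro e rfl h
        rfl
      exact he _ (openCell_eq_of_mem (hε b'.1) b'.2) _
    rw [this]
    fun_prop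
  exact hon.continuousAt hnhds

/-! ### Local path connectedness -/

/-- The complex is a quotient of a disjoint union of Euclidean spaces. At time zero the radial
formula retracts the whole space onto the closed ball, so the characteristic maps extend to all of
it. -/
lemma cw_locallyPathConnectedSpace : LocallyPathConnectedSpace B := by
  let π : (Σ e : (Σ n, cell (univ : Set B) n), (Fin e.1 → ℝ)) → B :=
    fun s => cellExpand s.1.2 s.2 0
  have hπ : ∀ {m : ℕ} (e : cell (univ : Set B) m) {x : Fin m → ℝ}, x ∈ closedBall 0 1 →
      π ⟨⟨m, e⟩, x⟩ = map m e x := by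
    intro m e x hx
    change map m e (radialExpand x 0) = _
    rw [radialExpand_zero (mem_closedBall_zero_iff.1 hx)]
  have hc : Continuous π := continuous_sigma fun e =>
    (continuous_eval_const (0 : I)).comp (cellExpand e.2).continuous
  have hsurj : Function.Surjective π := by
    intro b
    obtain ⟨m, e, x, hx, rfl⟩ := exists_mem_openCell b
    exact ⟨⟨⟨m, e⟩, x⟩, hπ e (ball_subset_closedBall hx)⟩
  refine IsQuotientMap.locallyPathConnectedSpace (f := π)
    (isQuotientMap_iff_isClosed.2 ⟨hsurj, fun A => ⟨fun hA => hA.preimage hc, fun hA => ?_⟩⟩)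
  refine CWComplex.isClosed_of_disjoint_openCell_or_isClosed_inter_closedCell
    (C := (univ : Set B)) (subset_univ _) fun m _ e => Or.inr ?_
  have h1 : A ∩ closedCell m e = map m e '' (closedBall 0 1 ∩ (fun x => π ⟨⟨m, e⟩, x⟩) ⁻¹' A) := by
    ext b
    constructor
    · rintro ⟨hb, x, hx, rfl⟩
      exact ⟨x, ⟨hx, by rwa [mem_preimage, hπ e hx]⟩, rfl⟩
    · rintro ⟨x, ⟨hx, hb⟩, rfl⟩
      rw [mem_preimage, hπ e hx] at hb
      exact ⟨hb, x, hx, rfl⟩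
  rw [h1]
  have hmk : Continuous (fun x : Fin m → ℝ =>
      (⟨⟨m, e⟩, x⟩ : Σ e : (Σ n, cell (univ : Set B) n), (Fin e.1 → ℝ))) :=
    @continuous_sigmaMk (Σ n, cell (univ : Set B) n) (fun e => Fin e.1 → ℝ) _ ⟨m, e⟩
  have h2 : IsCompact (closedBall (0 : Fin m → ℝ) 1 ∩ (fun x => π ⟨⟨m, e⟩, x⟩) ⁻¹' A) :=
    (isCompact_closedBall 0 1).inter_right (hA.preimage hmk)
  exact (h2.image_of_continuousOn ((continuousOn m e).mono inter_subset_left)).isClosed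

end CW
end

noncomputable section

/-! ### Path lifting functions -/

section PathLifting

variable {E X B : Type u} [TopologicalSpace E] [TopologicalSpace X] [TopologicalSpace B]

/-- The path `t ↦ ω (s - t)`, constant after time `s`. -/
def pathRev (s : I) (ω : C(I, B)) : C(I, B) :=
  ω.comp ⟨fun t => projIcc 0 1 zero_le_one ((s : ℝ) - t), by fun_prop⟩

/-- The path `t ↦ ω (s + t)`, constant after time `1 - s`. -/
def pathShift (s : I) (ω : C(I, B)) : C(I, B) :=
  ω.comp ⟨fun t => projIcc 0 1 zero_le_one ((s : ℝ) + t), by fun_prop⟩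

lemma pathRev_zero (s : I) (ω : C(I, B)) : pathRev s ω 0 = ω s := by
  simp [pathRev]

lemma pathRev_self (s : I) (ω : C(I, B)) : pathRev s ω s = ω 0 := by
  simp [pathRev]

lemma pathShift_zero (s : I) (ω : C(I, B)) : pathShift s ω 0 = ω s := by
  simp [pathShift]

lemma pathShift_zero_left (ω : C(I, B)) : pathShift 0 ω = ω := by
  ext t
  simp [pathShift]

lemma pathShift_symm (s : I) (ω : C(I, B)) : pathShift s ω (unitInterval.symm s) = ω 1 := by
  simp [pathShift]

lemma continuous_pathRev {Y : Type*} [TopologicalSpace Y] {s : Y → I} {ω : Y → C(I, B)}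
    (hs : Continuous s) (hω : Continuous ω) : Continuous fun a => pathRev (s a) (ω a) := by
  refine ContinuousMap.continuous_of_continuous_uncurry _ ?_
  change Continuous fun z : Y × I => ω z.1 (projIcc 0 1 zero_le_one ((s z.1 : ℝ) - z.2))
  fun_prop

lemma continuous_pathShift {Y : Type*} [TopologicalSpace Y] {s : Y → I} {ω : Y → C(I, B)}
    (hs : Continuous s) (hω : Continuous ω) : Continuous fun a => pathShift (s a) (ω a) := by
  refine ContinuousMap.continuous_of_continuous_uncurry _ ?_
  change Continuous fun z : Y × I => ω z.1 (projIcc 0 1 zero_le_one ((s z.1 : ℝ) + z.2))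
  fun_prop

/-- A continuous choice of lifts of paths along `q`; the value `lift t y ω` is meaningful
when `ω` starts at `q y`. -/
structure PathLifting (q : E → B) where
  lift : I → E → C(I, B) → E
  lift_zero : ∀ {y ω}, ω 0 = q y → lift 0 y ω = y
  proj_lift : ∀ t {y ω}, ω 0 = q y → q (lift t y ω) = ω t
  continuous_subtype : Continuous fun z : I × {z : E × C(I, B) // z.2 0 = q z.1} =>
    lift z.1 z.2.1.1 z.2.1.2

namespace PathLifting

variable {q : E → B} (L : PathLifting q)

lemma continuous_lift {Y : Type*} [TopologicalSpace Y] {t : Y → I} {y : Y → E}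
    {ω : Y → C(I, B)} (ht : Continuous t) (hy : Continuous y) (hω : Continuous ω)
    (h : ∀ a, ω a 0 = q (y a)) : Continuous fun a => L.lift (t a) (y a) (ω a) :=
  L.continuous_subtype.comp (ht.prodMk (Continuous.subtype_mk (hy.prodMk hω) h))

/-- Lift `ω` up to time `s`, and then lift the reversed path. -/
def back (s : I) (y : E) (ω : C(I, B)) : E := L.lift s (L.lift s y ω) (pathRev s ω)

lemma rev_zero_eq {s : I} {y : E} {ω : C(I, B)} (h : ω 0 = q y) :
    pathRev s ω 0 = q (L.lift s y ω) := by
  rw [pathRev_zero, L.proj_lift s h]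

lemma back_zero {y : E} {ω : C(I, B)} (h : ω 0 = q y) : L.back 0 y ω = y := by
  rw [back, L.lift_zero (L.rev_zero_eq h), L.lift_zero h]

/-- Going out along a path and back again ends over the starting point. So `back` is a deformation
of the identity within the fibres of q, even though lifts of a path and of its reverse need not be
inverse. -/
lemma proj_back (s : I) {y : E} {ω : C(I, B)} (h : ω 0 = q y) : q (L.back s y ω) = q y := by
  rw [back, L.proj_lift s (L.rev_zero_eq h), pathRev_self, h]

lemma continuous_back {Y : Type*} [TopologicalSpace Y] {t : Y → I} {y : Y → E}
    {ω : Y → C(I, B)} (ht : Continuous t) (hy : Continuous y) (hω : Continuous ω)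
    (h : ∀ a, ω a 0 = q (y a)) : Continuous fun a => L.back (t a) (y a) (ω a) :=
  L.continuous_lift ht (L.continuous_lift ht hy hω h) (continuous_pathRev ht hω)
    fun a => L.rev_zero_eq (h a)

end PathLifting

/-- The pairs of a point and a path starting at its image form the universal lifting problem.
Outside these pairs the lift gets the irrelevant default value y. -/
lemma IsHurewiczFibration.nonempty_pathLifting {f : C(X, B)} (hf : IsHurewiczFibration f) :
    Nonempty (PathLifting f) := by
  classical
  obtain ⟨K, hK0, hK⟩ := hf {z : X × C(I, B) // z.2 0 = f z.1}
    ⟨fun z => z.2.1.2 z.1, by fun_prop⟩ ⟨fun z => z.1.1, by fun_prop⟩ fun z => z.2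
  refine ⟨⟨fun t y ω => if h : ω 0 = f y then K (t, ⟨(y, ω), h⟩) else y, ?_, ?_, ?_⟩⟩
  · intro y ω h
    rw [dif_pos h]
    exact hK0 _
  · intro t y ω h
    rw [dif_pos h]
    exact hK _
  · refine K.continuous.congr fun z => ?_
    rw [dif_pos z.2.2]

lemma IsCoveringMap.exists_pathLifting {p : E → X} (cov : IsCoveringMap p) {f : C(X, B)}
    (LX : PathLifting f) : ∃ LE : PathLifting (fun y => f (p y)),
      ∀ t y ω, ω 0 = f (p y) → p (LE.lift t y ω) = LX.lift t (p y) ω := by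
  classical
  let H : C(I × {z : E × C(I, B) // z.2 0 = f (p z.1)}, X) := ⟨fun z => LX.lift z.1 (p z.2.1.1) z.2.1.2,
    LX.continuous_lift continuous_fst (cov.continuous.comp (by fun_prop)) (by fun_prop)
      fun z => z.2.2⟩
  let g : C({z : E × C(I, B) // z.2 0 = f (p z.1)}, E) := ⟨fun z => z.1.1, by fun_prop⟩
  have hH : ∀ z, H (0, z) = p (g z) := fun z => LX.lift_zero z.2
  let K := cov.liftHomotopy H g hH
  have hK : ∀ z, p (K z) = H z := fun z => congrFun (cov.liftHomotopy_lifts H g hH) z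
  have hK0 : ∀ z, K (0, z) = g z := cov.liftHomotopy_zero H g hH
  refine ⟨⟨fun t y ω => if h : ω 0 = f (p y) then K (t, ⟨(y, ω), h⟩) else y, ?_, ?_, ?_⟩, ?_⟩
  · intro y ω h
    rw [dif_pos h]
    exact hK0 _
  · intro t y ω h
    rw [dif_pos h, hK]
    exact LX.proj_lift t h
  · refine K.continuous.congr fun z => ?_
    rw [dif_pos z.2.2]
  · intro t y ω h
    refine (congrArg p (dif_pos h)).trans ?_
    exact hK _

/-- Both sides lift the same path of X and start at the same point, so unique path lifting makes the
lifting function equivariant. -/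
lemma lift_smul {G : Type v} [Group G] [MulAction G E] [ContinuousConstSMul G E] {p : E → X}
    (cov : IsCoveringMap p) (hp : ∀ (g : G) y, p (g • y) = p y) {f : C(X, B)}
    {LX : PathLifting f} {LE : PathLifting (fun y => f (p y))}
    (hL : ∀ t y ω, ω 0 = f (p y) → p (LE.lift t y ω) = LX.lift t (p y) ω)
    (g : G) (t : I) {y : E} {ω : C(I, B)} (h : ω 0 = f (p y)) :
    LE.lift t (g • y) ω = g • LE.lift t y ω := by
  have h' : ω 0 = f (p (g • y)) := by rw [hp, h]
  refine congrFun (cov.eq_of_comp_eq (g₁ := fun t => LE.lift t (g • y) ω)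
    (g₂ := fun t => g • LE.lift t y ω)
    (LE.continuous_lift continuous_id continuous_const continuous_const fun _ => h')
    ((LE.continuous_lift continuous_id continuous_const continuous_const fun _ => h).const_smul g)
    ?_ 0 ?_) t
  · funext t
    simp only [Function.comp_apply]
    rw [hL t _ ω h', hp, hp, hL t _ ω h]
  · rw [LE.lift_zero h', LE.lift_zero h]

lemma back_smul {G : Type v} [Group G] [MulAction G E] [ContinuousConstSMul G E] {p : E → X}
    (cov : IsCoveringMap p) (hp : ∀ (g : G) y, p (g • y) = p y) {f : C(X, B)}
    {LX : PathLifting f} {LE : PathLifting (fun y => f (p y))}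
    (hL : ∀ t y ω, ω 0 = f (p y) → p (LE.lift t y ω) = LX.lift t (p y) ω)
    (g : G) (t : I) {y : E} {ω : C(I, B)} (h : ω 0 = f (p y)) :
    LE.back t (g • y) ω = g • LE.back t y ω := by
  rw [PathLifting.back, PathLifting.back, lift_smul cov hp hL g t h,
    lift_smul cov hp hL g t (LE.rev_zero_eq h)]

/-- A homotopy over `b₀` from the identity of the fibre of `E` over `b₀` to the action of `a` can be
transported along a continuous family of paths ending at `b₀`. -/
theorem exists_homotopy_smul_of_paths {G : Type v} [Group G] [MulAction G E]
    [ContinuousConstSMul G E] {p : E → X} (cov : IsCoveringMap p)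
    (hp : ∀ (g : G) y, p (g • y) = p y) {f : C(X, B)}
    {LX : PathLifting f} {LE : PathLifting (fun y => f (p y))}
    (hL : ∀ t y ω, ω 0 = f (p y) → p (LE.lift t y ω) = LX.lift t (p y) ω)
    (a : G) {b₀ : B} (K : C(I × ((fun y => f (p y)) ⁻¹' {b₀}), E))
    (hK0 : ∀ y, K (0, y) = y) (hK1 : ∀ y, K (1, y) = a • (y : E))
    (hK : ∀ z, f (p (K z)) = b₀)
    {Y : Type*} [TopologicalSpace Y] (y : C(Y, E)) (ω : C(Y, C(I, B)))
    (hω0 : ∀ c, ω c 0 = f (p (y c))) (hω1 : ∀ c, ω c 1 = b₀) :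
    ∃ H : C(I × Y, E), (∀ c, H (0, c) = y c) ∧ (∀ c, H (1, c) = a • y c) ∧
      ∀ s c, f (p (H (s, c))) = f (p (y c)) := by
  -- All homotopies are kept over B: every stage has the same image in B as y.
  let P : C(Y, E) → Prop := fun m => ∀ c, f (p (m c)) = f (p (y c))
  have hω0a : ∀ c, ω c 0 = f (p (a • y c)) := fun c => by rw [hp, hω0]
  have hT : ∀ c, LE.lift 1 (y c) (ω c) ∈ (fun y => f (p y)) ⁻¹' {b₀} := fun c => by
    rw [mem_preimage, mem_singleton_iff, ← hω1 c]
    exact LE.proj_lift 1 (hω0 c)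
  let m : C(Y, E) := ⟨fun c => LE.back 1 (y c) (ω c),
    LE.continuous_back continuous_const y.continuous ω.continuous hω0⟩
  let m' : C(Y, E) := ⟨fun c => LE.back 1 (a • y c) (ω c),
    LE.continuous_back continuous_const (y.continuous.const_smul a) ω.continuous hω0a⟩
  let y' : C(Y, E) := ⟨fun c => a • y c, y.continuous.const_smul a⟩
  have h1 : ContinuousMap.HomotopicWith y m P :=
    ⟨{ toFun := fun z => LE.back z.1 (y z.2) (ω z.2)
       continuous_toFun := LE.continuous_back continuous_fst (by fun_prop) (by fun_prop)
        fun z => hω0 z.2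
       map_zero_left := fun c => LE.back_zero (hω0 c)
       map_one_left := fun c => rfl
       prop' := fun t c => LE.proj_back t (hω0 c) }⟩
  have h2 : ContinuousMap.HomotopicWith y' m' P :=
    ⟨{ toFun := fun z => LE.back z.1 (a • y z.2) (ω z.2)
       continuous_toFun := LE.continuous_back continuous_fst
        ((y.continuous.comp continuous_snd).const_smul a) (by fun_prop) fun z => hω0a z.2
       map_zero_left := fun c => LE.back_zero (hω0a c)
       map_one_left := fun c => rfl
       prop' := fun t c => (LE.proj_back t (hω0a c)).trans (by rw [hp]) }⟩
  have hr : ∀ (t : I) c, pathRev 1 (ω c) 0 = f (p (K (t, ⟨_, hT c⟩))) := fun t c => by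
    rw [hK, pathRev_zero, hω1]
  -- Between going out to the fibre over b₀ and coming back, apply the homotopy K. At its end the
  -- factor a can be moved to the starting point by equivariance of lifting.
  have h3 : ContinuousMap.HomotopicWith m m' P :=
    ⟨{ toFun := fun z => LE.lift 1 (K (z.1, ⟨_, hT z.2⟩)) (pathRev 1 (ω z.2))
       continuous_toFun := LE.continuous_lift continuous_const
        (K.continuous.comp (continuous_fst.prodMk (Continuous.subtype_mk
          (LE.continuous_lift (y := fun z : I × Y => y z.2) (ω := fun z => ω z.2)
            continuous_const (by fun_prop) (by fun_prop) fun z => hω0 z.2) _)))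
        (continuous_pathRev continuous_const (by fun_prop)) fun z => hr z.1 z.2
       map_zero_left := fun c => by
        simp only [hK0]
        rfl
       map_one_left := fun c => by
        simp only [hK1]
        change _ = LE.back 1 (a • y c) (ω c)
        rw [PathLifting.back, lift_smul cov hp hL a 1 (hω0 c)]
       prop' := fun t c => by
        refine (LE.proj_lift 1 (hr t c)).trans ?_
        rw [pathRev_self, hω0] }⟩
  obtain ⟨H⟩ := (h1.trans h3).trans h2.symm
  exact ⟨H.toContinuousMap, H.apply_zero, H.apply_one, fun s c => H.prop s c⟩

end PathLifting
end

noncomputable section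

/-! ### Motions of the fibre -/

section FibreMotion

variable {E X B : Type u} [TopologicalSpace E] [TopologicalSpace X] [TopologicalSpace B]

lemma IsLocalHomeomorph.locallyConnectedSpace {p : E → X} (hp : IsLocalHomeomorph p)
    [LocallyConnectedSpace X] : LocallyConnectedSpace E := by
  let _ : ChartedSpace X E :=
    { atlas := range fun x => (hp x).choose
      chartAt := fun x => (hp x).choose
      mem_chart_source := fun x => (hp x).choose_spec.1
      chart_mem_atlas := fun x => mem_range_self x }
  exact ChartedSpace.locallyConnectedSpace X E

/-- The maps `m₀` and `m₁` from the fibre of `f` over `b₀` to itself are homotopic over `b₀`, and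
the track of `u` under the homotopy lifts to a path from `y₀` to `y₁` along `p`. -/
def TrackJoined (p : E → X) (f : C(X, B)) (b₀ : B) (u : f ⁻¹' {b₀})
    (m₀ m₁ : f ⁻¹' {b₀} → X) (y₀ y₁ : E) : Prop :=
  ∃ (k : C(I × (f ⁻¹' {b₀}), X)) (Γ : C(I, E)), (∀ w, k (0, w) = m₀ w) ∧ (∀ w, k (1, w) = m₁ w) ∧
    (∀ z, f (k z) = b₀) ∧ Γ 0 = y₀ ∧ Γ 1 = y₁ ∧ ∀ t, p (Γ t) = k (t, u)

namespace TrackJoined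

variable {p : E → X} {f : C(X, B)} {b₀ : B} {u : f ⁻¹' {b₀}} {m₀ m₁ m₂ : f ⁻¹' {b₀} → X}
  {y₀ y₁ y₂ : E}

lemma symm (h : TrackJoined p f b₀ u m₀ m₁ y₀ y₁) : TrackJoined p f b₀ u m₁ m₀ y₁ y₀ := by
  obtain ⟨k, Γ, h0, h1, hk, hΓ0, hΓ1, hΓ⟩ := h
  exact ⟨⟨fun z => k (unitInterval.symm z.1, z.2), by fun_prop⟩,
    ⟨fun t => Γ (unitInterval.symm t), by fun_prop⟩, fun w => by simp [h1], fun w => by simp [h0],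
    fun z => hk _, by simp [hΓ1], by simp [hΓ0], fun t => hΓ _⟩

lemma trans (h : TrackJoined p f b₀ u m₀ m₁ y₀ y₁) (h' : TrackJoined p f b₀ u m₁ m₂ y₁ y₂) :
    TrackJoined p f b₀ u m₀ m₂ y₀ y₂ := by
  obtain ⟨k, Γ, h0, h1, hk, hΓ0, hΓ1, hΓ⟩ := h
  obtain ⟨k', Γ', h0', h1', hk', hΓ0', hΓ1', hΓ'⟩ := h'
  let c : C(I × (f ⁻¹' {b₀}), X) → I → C(f ⁻¹' {b₀}, X) := fun k t =>
    ⟨fun w => k (t, w), by fun_prop⟩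
  let H : ContinuousMap.Homotopy (c k 0) (c k 1) :=
    { toContinuousMap := k, map_zero_left := fun _ => rfl, map_one_left := fun _ => rfl }
  let H' : ContinuousMap.Homotopy (c k 1) (c k' 1) :=
    { toContinuousMap := k'
      map_zero_left := fun w => (h0' w).trans (h1 w).symm
      map_one_left := fun _ => rfl }
  let γ : Path y₀ y₁ := { toContinuousMap := Γ, source' := hΓ0, target' := hΓ1 }
  let γ' : Path y₁ y₂ := { toContinuousMap := Γ', source' := hΓ0', target' := hΓ1' }
  refine ⟨(H.trans H').toContinuousMap, (γ.trans γ').toContinuousMap, fun w => ?_, fun w => ?_,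
    fun z => ?_, Path.source _, Path.target _, fun t => ?_⟩
  · exact ((H.trans H').apply_zero w).trans (h0 w)
  · exact ((H.trans H').apply_one w).trans (h1' w)
  · change f ((H.trans H') z) = b₀
    rw [ContinuousMap.Homotopy.trans_apply]
    split_ifs
    · exact hk _
    · exact hk' _
  · change p (γ.trans γ' t) = (H.trans H') (t, u)
    rw [ContinuousMap.Homotopy.trans_apply, Path.trans_apply]
    split_ifs
    · exact hΓ _
    · exact hΓ' _

lemma smul {G : Type v} [Group G] [MulAction G E] [ContinuousConstSMul G E]
    (hp : ∀ (g : G) y, p (g • y) = p y) (g : G) (h : TrackJoined p f b₀ u m₀ m₁ y₀ y₁) :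
    TrackJoined p f b₀ u m₀ m₁ (g • y₀) (g • y₁) := by
  obtain ⟨k, Γ, h0, h1, hk, hΓ0, hΓ1, hΓ⟩ := h
  exact ⟨k, ⟨fun t => g • Γ t, Γ.continuous.const_smul g⟩, h0, h1, hk, by simp [hΓ0],
    by simp [hΓ1], fun t => (hp g _).trans (hΓ t)⟩

end TrackJoined

/-- The element `a` moves `x` along a loop of self-maps of the fibre of `f` over `b₀`. -/
def IsFibreMotion {G : Type v} [Group G] [MulAction G E] (p : E → X) (f : C(X, B)) (b₀ : B)
    (x : E) (a : G) : Prop :=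
  ∃ u : f ⁻¹' {b₀}, (u : X) = p x ∧ TrackJoined p f b₀ u (fun w => w) (fun w => w) x (a • x)

variable {G : Type v} [Group G] [MulAction G E] [ContinuousConstSMul G E] {p : E → X}
  {f : C(X, B)} {b₀ : B}

lemma IsFibreMotion.smul (hp : ∀ (g : G) y, p (g • y) = p y) {x : E} {a : G}
    (h : IsFibreMotion p f b₀ x a) (g : G) : IsFibreMotion p f b₀ (g • x) (g * a * g⁻¹) := by
  obtain ⟨u, hu, h⟩ := h
  refine ⟨u, by rw [hu, hp], ?_⟩
  have := h.smul hp g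
  rwa [show g • a • x = (g * a * g⁻¹) • g • x by simp [mul_smul]] at this

/-- The lift to `E` of a homotopy of the fibre starting at the inclusion. -/
lemma exists_fibreLift (cov : IsCoveringMap p) (k : C(I × (f ⁻¹' {b₀}), X))
    (hk : ∀ w, k (0, w) = w) : ∃ K : C(I × ((fun y => f (p y)) ⁻¹' {b₀}), E),
      (∀ y, K (0, y) = y) ∧ ∀ s y, p (K (s, y)) = k (s, ⟨p y, y.2⟩) := by
  let H : C(I × ((fun y => f (p y)) ⁻¹' {b₀}), X) := ⟨fun z => k (z.1, ⟨p z.2, z.2.2⟩),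
    k.continuous.comp (continuous_fst.prodMk (Continuous.subtype_mk
      (cov.continuous.comp (continuous_subtype_val.comp continuous_snd)) _))⟩
  let g : C((fun y => f (p y)) ⁻¹' {b₀}, E) := ⟨fun y => y, continuous_subtype_val⟩
  have hH : ∀ y, H (0, y) = p (g y) := fun y => hk _
  exact ⟨cov.liftHomotopy H g hH, cov.liftHomotopy_zero H g hH,
    fun s y => congrFun (cov.liftHomotopy_lifts H g hH) (s, y)⟩

lemma fibreLift_eq_of_lift (cov : IsCoveringMap p) {k : C(I × (f ⁻¹' {b₀}), X)}
    {K : C(I × ((fun y => f (p y)) ⁻¹' {b₀}), E)} (hK0 : ∀ y, K (0, y) = y)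
    (hK : ∀ s y, p (K (s, y)) = k (s, ⟨p y, y.2⟩)) (y : (fun y => f (p y)) ⁻¹' {b₀}) (Γ : C(I, E))
    (hΓ0 : Γ 0 = y) (hΓ : ∀ t, p (Γ t) = k (t, ⟨p y, y.2⟩)) (t : I) : K (t, y) = Γ t := by
  refine congrFun (cov.eq_of_comp_eq (g₁ := fun t => K (t, y)) (by fun_prop) Γ.continuous ?_ 0 ?_) t
  · funext t
    simp [hK, hΓ]
  · simp [hK0, hΓ0]

/-- Both the end stage of the lift and the action of a cover the identity of the fibre. Agreement at
one point therefore spreads over its connected component. -/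
lemma fibreLift_eq_smul (cov : IsCoveringMap p) (hp : ∀ (g : G) y, p (g • y) = p y)
    {k : C(I × (f ⁻¹' {b₀}), X)} (hk1 : ∀ w, k (1, w) = w)
    {K : C(I × ((fun y => f (p y)) ⁻¹' {b₀}), E)}
    (hK : ∀ s y, p (K (s, y)) = k (s, ⟨p y, y.2⟩)) {a : G} {y y' : (fun y => f (p y)) ⁻¹' {b₀}}
    (hy : K (1, y) = a • (y : E)) (hy' : y' ∈ connectedComponent y) :
    K (1, y') = a • (y' : E) := by
  refine cov.eqOn_of_comp_eqOn (s := connectedComponent y) (g₁ := fun y => K (1, y))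
    (g₂ := fun y => a • (y : E)) isPreconnected_connectedComponent
    (by fun_prop) (continuous_subtype_val.const_smul a).continuousOn ?_ mem_connectedComponent
    hy hy'
  intro w _
  simp [hK, hk1, hp]

lemma IsFibreMotion.exists_fibreLift (cov : IsCoveringMap p) (hp : ∀ (g : G) y, p (g • y) = p y)
    {y : (fun y => f (p y)) ⁻¹' {b₀}} {a : G} (h : IsFibreMotion p f b₀ (y : E) a) :
    ∃ (k : C(I × (f ⁻¹' {b₀}), X)) (K : C(I × ((fun y => f (p y)) ⁻¹' {b₀}), E)),
      (∀ w, k (0, w) = w) ∧ (∀ w, k (1, w) = w) ∧ (∀ z, f (k z) = b₀) ∧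
      (∀ y, K (0, y) = y) ∧ (∀ s y, p (K (s, y)) = k (s, ⟨p y, y.2⟩)) ∧
      ∀ y' ∈ connectedComponent y, K (1, y') = a • (y' : E) := by
  obtain ⟨u, hu, k, Γ, hk0, hk1, hk, hΓ0, hΓ1, hΓ⟩ := h
  obtain ⟨K, hK0, hK⟩ := _root_.exists_fibreLift cov k hk0
  refine ⟨k, K, hk0, hk1, hk, hK0, hK, fun y' hy' => fibreLift_eq_smul cov hp hk1 hK ?_ hy'⟩
  rw [fibreLift_eq_of_lift cov hK0 hK y Γ hΓ0 (fun t => ?_), hΓ1]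
  rw [hΓ, show u = ⟨p y, y.2⟩ from Subtype.ext hu]

lemma isFibreMotion_of_mem_connectedComponent (cov : IsCoveringMap p)
    (hp : ∀ (g : G) y, p (g • y) = p y) {y y' : (fun y => f (p y)) ⁻¹' {b₀}} {a : G}
    (h : IsFibreMotion p f b₀ (y : E) a) (hy' : y' ∈ connectedComponent y) :
    IsFibreMotion p f b₀ (y' : E) a := by
  obtain ⟨k, K, hk0, hk1, hk, hK0, hK, hK1⟩ := h.exists_fibreLift cov hp
  exact ⟨⟨p y', y'.2⟩, rfl, k, ⟨fun t => K (t, y'), by fun_prop⟩, hk0, hk1, hk, hK0 y', hK1 y' hy',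
    fun t => hK t y'⟩

/-- Fibre motions at different points of the fibre of a path connected covering agree. -/
theorem IsFibreMotion.transport (cov : IsCoveringMap p)
    (hp : ∀ (g : G) y, p (g • y) = p y)
    {LX : PathLifting f} {LE : PathLifting (fun y => f (p y))}
    (hL : ∀ t y ω, ω 0 = f (p y) → p (LE.lift t y ω) = LX.lift t (p y) ω)
    {x x' : E} {a : G} (h : IsFibreMotion p f b₀ x a) (hx' : f (p x') = b₀) (hj : Joined x' x) :
    IsFibreMotion p f b₀ x' a := by
  obtain ⟨β⟩ := hj
  have hx : f (p x) = b₀ := by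
    obtain ⟨u, hu, -⟩ := h
    rw [← hu]
    exact u.2
  let ω : C(I, B) := ⟨fun t => f (p (β t)), f.continuous.comp (cov.continuous.comp β.continuous)⟩
  have hω0 : ω 0 = b₀ := by simp [ω, hx']
  have hω1 : ω 1 = b₀ := by simp [ω, hx]
  have hωu : ∀ w : f ⁻¹' {b₀}, ω 0 = f w := fun w => hω0.trans w.2.symm
  have hωx : ω 0 = f (p x') := hω0.trans hx'.symm
  have hωa : ω 0 = f (p (a • x')) := by rw [hp, hωx]
  let T : (fun y => f (p y)) ⁻¹' {b₀} := ⟨LE.lift 1 x' ω, (LE.proj_lift 1 hωx).trans hω1⟩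
  -- Lifting the rest of the path from each point β(s) gives a path in the fibre over b₀ from T to
  -- x. So T and x share a component, and the motion moves from x to T.
  have hT : IsFibreMotion p f b₀ (T : E) a := by
    have hs : ∀ s, pathShift s ω 0 = f (p (β s)) := fun s => pathShift_zero s ω
    let c : I → (fun y => f (p y)) ⁻¹' {b₀} := fun s =>
      ⟨LE.lift (unitInterval.symm s) (β s) (pathShift s ω), by
        rw [mem_preimage, mem_singleton_iff]
        exact (LE.proj_lift _ (hs s)).trans ((pathShift_symm s ω).trans hω1)⟩
    have hc : Continuous c := Continuous.subtype_mk (LE.continuous_lift (by fun_prop) β.continuous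
      (continuous_pathShift continuous_id continuous_const) hs) _
    have hc1 : c 1 = ⟨x, hx⟩ := Subtype.ext (by
      have := LE.lift_zero (hs 1)
      simpa [c] using this)
    have hc0 : c 0 = T := Subtype.ext (by simp [c, T, pathShift_zero_left])
    refine isFibreMotion_of_mem_connectedComponent cov hp (y := ⟨x, hx⟩) h ?_
    rw [← hc0, ← hc1]
    exact (isPreconnected_range hc).subset_connectedComponent ⟨1, rfl⟩ ⟨0, rfl⟩
  obtain ⟨u, hu, k, Γ, hk0, hk1, hk, hΓ0, hΓ1, hΓ⟩ := hT
  have hpb : ∀ t y, ω 0 = f (p y) → p (LE.back t y ω) = LX.back t (p y) ω := fun t y h => by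
    rw [PathLifting.back, hL _ _ _ (LE.rev_zero_eq h), hL _ _ _ h]
    rfl
  have h1 : TrackJoined p f b₀ ⟨p x', hx'⟩ (fun w => w) (fun w => LX.back 1 w ω) x'
      (LE.back 1 x' ω) :=
    ⟨⟨fun z => LX.back z.1 z.2 ω, LX.continuous_back continuous_fst (by fun_prop) (by fun_prop)
        fun z => hωu z.2⟩,
      ⟨fun t => LE.back t x' ω, LE.continuous_back continuous_id (by fun_prop) (by fun_prop)
        fun _ => hωx⟩,
      fun w => LX.back_zero (hωu w), fun w => rfl,
      fun z => (LX.proj_back z.1 (hωu z.2)).trans z.2.2, LE.back_zero hωx, rfl,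
      fun t => hpb t x' hωx⟩
  have hTX : ∀ w : f ⁻¹' {b₀}, f (LX.lift 1 w ω) = b₀ := fun w =>
    (LX.proj_lift 1 (hωu w)).trans hω1
  have hr : ∀ z, pathRev 1 ω 0 = f (k z) := fun z => by rw [hk, pathRev_zero, hω1]
  have hrΓ : ∀ t, pathRev 1 ω 0 = f (p (Γ t)) := fun t => by rw [hΓ, ← hr]
  -- Go out along ω, perform the motion at T, and come back. With the deformations `h1` and the
  -- a-translate of its reverse this yields a homotopy from the identity to itself.
  have h2 : TrackJoined p f b₀ ⟨p x', hx'⟩ (fun w => LX.back 1 w ω) (fun w => LX.back 1 w ω)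
      (LE.back 1 x' ω) (LE.back 1 (a • x') ω) := by
    refine ⟨⟨fun z => LX.lift 1 (k (z.1, ⟨LX.lift 1 z.2 ω, hTX z.2⟩)) (pathRev 1 ω),
        LX.continuous_lift continuous_const (k.continuous.comp (continuous_fst.prodMk
          (Continuous.subtype_mk (LX.continuous_lift continuous_const
            (continuous_subtype_val.comp continuous_snd) continuous_const
            fun z : I × (f ⁻¹' {b₀}) => hωu z.2) _)))
          continuous_const fun z => hr _⟩,
      ⟨fun t => LE.lift 1 (Γ t) (pathRev 1 ω), LE.continuous_lift continuous_const Γ.continuous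
        continuous_const hrΓ⟩, ?_, ?_, ?_, ?_, ?_, ?_⟩
    · intro w
      simp only [ContinuousMap.coe_mk, hk0]
      rfl
    · intro w
      simp only [ContinuousMap.coe_mk, hk1]
      rfl
    · intro z
      refine (LX.proj_lift 1 (hr _)).trans ?_
      rw [pathRev_self, hω0]
    · simp only [ContinuousMap.coe_mk, hΓ0]
      rfl
    · simp only [ContinuousMap.coe_mk, hΓ1]
      rw [PathLifting.back, lift_smul cov hp hL a 1 hωx]
    · intro t
      refine (hL 1 _ _ (hrΓ t)).trans ?_
      rw [hΓ, show u = ⟨LX.lift 1 (p x') ω, hTX ⟨p x', hx'⟩⟩ from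
        Subtype.ext (hu.trans (hL 1 x' ω hωx))]
      rfl
  have h3 := h1.smul hp a
  rw [← back_smul cov hp hL a 1 hωx] at h3
  exact ⟨⟨p x', hx'⟩, rfl, (h1.trans h2).trans h3.symm⟩

/-- Fibre motions commute when the action is free. -/
lemma IsFibreMotion.smul_smul_comm (cov : IsCoveringMap p) (hp : ∀ (g : G) y, p (g • y) = p y)
    {x : E} {a b : G} (ha : IsFibreMotion p f b₀ x a) (hb : IsFibreMotion p f b₀ x b) :
    a • b • x = b • a • x := by
  have hx : f (p x) = b₀ := by
    obtain ⟨u, hu, -⟩ := ha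
    rw [← hu]
    exact u.2
  have hbx : f (p (b • x)) = b₀ := by rw [hp, hx]
  obtain ⟨k, K, hk0, hk1, hk, hK0, hK, hK1⟩ :=
    IsFibreMotion.exists_fibreLift cov hp (y := ⟨x, hx⟩) ha
  -- The lifted track of b is a path in the fibre from x to b • x, so the lift for a acts by a at b
  -- • x as well.
  have h1 : K (1, ⟨b • x, hbx⟩) = a • b • x := by
    refine hK1 _ ?_
    obtain ⟨u, hu, l, Γ, -, -, hl, hΓ0, hΓ1, hΓ⟩ := hb
    have hmem : ∀ t, Γ t ∈ (fun y => f (p y)) ⁻¹' {b₀} := fun t => by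
      rw [mem_preimage, hΓ, hl]
      rfl
    have hc : Continuous fun t => (⟨Γ t, hmem t⟩ : (fun y => f (p y)) ⁻¹' {b₀}) :=
      Γ.continuous.subtype_mk _
    exact (isPreconnected_range hc).subset_connectedComponent ⟨0, Subtype.ext hΓ0⟩
      ⟨1, Subtype.ext hΓ1⟩
  rw [← h1, ← hK1 ⟨x, hx⟩ mem_connectedComponent]
  -- The b-translate of the lifted track through x starts at b • x and covers the same path, because
  -- x and b • x have the same image.
  refine fibreLift_eq_of_lift cov hK0 hK ⟨b • x, hbx⟩
    ⟨fun t => b • K (t, ⟨x, hx⟩), Continuous.const_smul (by fun_prop) b⟩ ?_ ?_ 1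
  · simp [hK0]
  · intro t
    simp only [ContinuousMap.coe_mk, hp, hK]

/-- If `a` is a fibre motion at every point, then the action of `a` on the fibre is homotopic to the
identity within the fibre. -/
theorem exists_fibre_homotopy_smul (cov : IsCoveringMap p) (hp : ∀ (g : G) y, p (g • y) = p y)
    [LocallyConnectedSpace ((fun y => f (p y)) ⁻¹' {b₀})] {a : G}
    (ha : ∀ y, f (p y) = b₀ → IsFibreMotion p f b₀ y a) :
    ∃ K : C(I × ((fun y => f (p y)) ⁻¹' {b₀}), E), (∀ y, K (0, y) = y) ∧
      (∀ y, K (1, y) = a • (y : E)) ∧ ∀ z, f (p (K z)) = b₀ := by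
  have h : ∀ y : (fun y => f (p y)) ⁻¹' {b₀}, _ := fun y =>
    IsFibreMotion.exists_fibreLift cov hp (ha y y.2)
  choose k K hk0 hk1 hk hK0 hK hK1 using h
  -- One representative per component makes the choice of lift locally constant, since components
  -- are open; so the lifts glue to a continuous map.
  let c : (fun y => f (p y)) ⁻¹' {b₀} → (fun y => f (p y)) ⁻¹' {b₀} := fun y =>
    Quotient.out (y : ConnectedComponents ((fun y => f (p y)) ⁻¹' {b₀}))
  have hc : ∀ y, y ∈ connectedComponent (c y) := fun y => by
    have : ((c y : _) : ConnectedComponents ((fun y => f (p y)) ⁻¹' {b₀})) = y := Quotient.out_eq _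
    rw [ConnectedComponents.coe_eq_coe.1 this]
    exact mem_connectedComponent
  refine ⟨⟨fun z => K (c z.2) z, continuous_iff_continuousAt.2 fun z => ?_⟩,
    fun y => hK0 _ y, fun y => hK1 _ y (hc y), fun z => ?_⟩
  · refine (K (c z.2)).continuous.continuousAt.congr ?_
    have hn : connectedComponent z.2 ∈ 𝓝 z.2 := isOpen_connectedComponent.mem_nhds
      mem_connectedComponent
    filter_upwards [continuous_snd.continuousAt.preimage_mem_nhds hn] with w hw
    have : (w.2 : ConnectedComponents ((fun y => f (p y)) ⁻¹' {b₀})) = z.2 :=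
      ConnectedComponents.coe_eq_coe'.2 hw
    simp only [c, this]
  · change f (p (K (c z.2) (z.1, z.2))) = b₀
    rw [hK, hk]

end FibreMotion
end

noncomputable section

/-! ### Induction over the skeleta of the base -/

section Kill

variable {E X B : Type u} [TopologicalSpace E] [TopologicalSpace X] [TopologicalSpace B]
  {G : Type v} [Group G] [MulAction G E] [ContinuousConstSMul G E] {p : E → X} {f : C(X, B)}

/-- Induction over the skeleta: cycles over the `k`-skeleton are killed in `k` steps. -/
theorem kill_over_cwSkel [T2Space B] [CWComplex (univ : Set B)] [PathConnectedSpace B]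
    (cov : IsCoveringMap p) (hp : ∀ (g : G) y, p (g • y) = p y)
    {LX : PathLifting f} {LE : PathLifting (fun y => f (p y))}
    (hL : ∀ t y ω, ω 0 = f (p y) → p (LE.lift t y ω) = LX.lift t (p y) ω)
    (A : Subgroup G) {b₀ : B}
    (hA : ∀ a ∈ A, ∃ K : C(I × ((fun y => f (p y)) ⁻¹' {b₀}), E), (∀ y, K (0, y) = y) ∧
      (∀ y, K (1, y) = a • (y : E)) ∧ ∀ z, f (p (K z)) = b₀) (n k : ℕ) :
    ∀ z ∈ SingChain.inside ((fun y => f (p y)) ⁻¹' cwSkel B k) (n + 1), SingChain.IsCycle n z →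
      SingChain.Kill (fun a : A => (⟨fun x => (a : G) • x, continuous_const_smul (a : G)⟩ : C(E, E)))
        ((fun y => f (p y)) ⁻¹' cwSkel B k) n k z := by
  have hq : Continuous fun y => f (p y) := f.continuous.comp cov.continuous
  induction k with
  | zero =>
    intro z hz _
    rw [cwSkel_zero, preimage_empty] at hz
    rw [SingChain.inside_empty hz]
    exact ⟨0, Submodule.zero_mem _, map_zero _⟩
  | succ k ih =>
    intro z hz hcyc
    obtain ⟨U, Φ, hU, hkU, hΦ0, hΦ, hΦ1⟩ := exists_skeleton_deformation (B := B) k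
    obtain ⟨Ψ, hΨ⟩ := exists_openCells_contraction (B := B) k b₀
    refine SingChain.kill_succ_of_cover (U' := (fun y => f (p y)) ⁻¹' U)
      (V' := (fun y => f (p y)) ⁻¹' (cwSkel B k)ᶜ) (hU.preimage hq)
      ((isClosed_cwSkel k).isOpen_compl.preimage hq) ?_ ?_ ?_ ?_ ?_ hz hcyc
    · intro y _
      by_cases hy : f (p y) ∈ cwSkel B k
      · exact Or.inl (hkU hy)
      · exact Or.inr hy
    · intro a y hy
      change f (p ((a : G) • y)) ∈ cwSkel B (k + 1)
      rwa [hp]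
    · intro a y hy
      change f (p ((a : G) • y)) ∈ cwSkel B (k + 1) ∧ f (p ((a : G) • y)) ∈ U
      rwa [hp]
    · intro a
      obtain ⟨K, hK0, hK1, hK⟩ := hA a a.2
      -- The homotopy exists over all open k-cells at once. As it moves points only within fibres of
      -- q, it preserves the part over U.
      obtain ⟨H, hH0, hH1, hH⟩ := exists_homotopy_smul_of_paths cov hp hL (a : G) K hK0 hK1 hK
        (Y := ↥((fun y => f (p y)) ⁻¹' cwSkel B (k + 1) ∩ (fun y => f (p y)) ⁻¹' (cwSkel B k)ᶜ))
        ⟨fun y => y, continuous_subtype_val⟩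
        (Ψ.comp ⟨fun y => ⟨f (p y), y.2⟩, (hq.comp continuous_subtype_val).subtype_mk _⟩)
        (fun y => (hΨ _).1) (fun y => (hΨ _).2)
      refine ⟨H, hH0, hH1, fun s y => ?_, fun s y hy => ?_⟩
      · change f (p (H (s, y))) ∈ cwSkel B (k + 1)
        rw [hH]
        exact y.2.1
      · change f (p (H (s, y))) ∈ cwSkel B (k + 1) ∧ f (p (H (s, y))) ∈ U
        rw [hH]
        exact hy
    · intro z hz hcyc
      have hω : ∀ y : ↥((fun y => f (p y)) ⁻¹' cwSkel B (k + 1)),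
          Φ ⟨f (p y), y.2⟩ 0 = f (p y) := fun y => hΦ0 _
      refine SingChain.kill_of_deformation
        (S := (fun y => f (p y)) ⁻¹' cwSkel B k) ?_ inter_subset_left
        (preimage_mono (cwSkel_mono k.le_succ))
        ⟨fun w => LE.lift w.1 w.2 (Φ ⟨f (p w.2), w.2.2⟩), LE.continuous_lift continuous_fst
          (by fun_prop) (Φ.continuous.comp
            ((hq.comp (continuous_subtype_val.comp continuous_snd)).subtype_mk _))
          fun w => hω w.2⟩ ?_ ?_ ?_ ih hz hcyc
      · intro a y hy
        change f (p ((a : G) • y)) ∈ cwSkel B (k + 1)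
        rwa [hp]
      · intro y
        exact LE.lift_zero (hω y)
      · intro s y
        change f (p (LE.lift s y (Φ ⟨f (p y), y.2⟩))) ∈ cwSkel B (k + 1)
        rw [LE.proj_lift s (hω y)]
        exact hΦ _ _
      · intro y hy
        change f (p (LE.lift 1 y (Φ ⟨f (p y), y.2⟩))) ∈ cwSkel B k
        rw [LE.proj_lift 1 (hω y)]
        exact hΦ1 _ hy.2

end Kill

/-! ### The image of Gottlieb's group -/

section Gottlieb

variable {F X B E : Type u} [TopologicalSpace F] [TopologicalSpace X] [TopologicalSpace B]
  [TopologicalSpace E] {G : Type v} [Group G] [MulAction G E] {j : C(F, X)} {f : C(X, B)}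
  {e₀ : F} {p : E → X}

/-- The homeomorphism from `F` onto the fibre. -/
def IsFibrationWithFibre.homeomorph {b₀ : B} (hf : IsFibrationWithFibre j f b₀) :
    F ≃ₜ f ⁻¹' {b₀} :=
  hf.isEmbedding.toHomeomorph.trans (Homeomorph.setCongr hf.range_eq)

lemma IsFibrationWithFibre.coe_homeomorph {b₀ : B} (hf : IsFibrationWithFibre j f b₀) (x : F) :
    (hf.homeomorph x : X) = j x := rfl

lemma IsFibrationWithFibre.j_symm {b₀ : B} (hf : IsFibrationWithFibre j f b₀)
    (u : f ⁻¹' {b₀}) : j (hf.homeomorph.symm u) = u := by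
  rw [← hf.coe_homeomorph, Homeomorph.apply_symm_apply]

/-- Any lift of the track starting at e is the monodromy lift, by uniqueness. The inverse comes from
the convention relating monodromy to φ. -/
lemma monodromy_trackLoop (cov : IsCoveringMap p) (φ : FundamentalGroup X (j e₀) →* G)
    (e : p ⁻¹' {j e₀})
    (he : ∀ γ : FundamentalGroup X (j e₀), (cov.monodromy γ.toPath e : E) = (φ γ)⁻¹ • (e : E))
    (h : ContinuousMap.Homotopy (ContinuousMap.id F) (ContinuousMap.id F)) (Γ : C(I, E))
    (hΓ0 : Γ 0 = e) (hΓ : ∀ t, p (Γ t) = j (h (t, e₀))) :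
    Γ 1 = (φ.comp (FundamentalGroup.map j e₀)
      (FundamentalGroup.fromPath (Path.Homotopic.Quotient.mk (trackLoop e₀ h))))⁻¹ • (e : E) := by
  rw [MonoidHom.comp_apply, ← he]
  change Γ 1 = cov.liftPath ((trackLoop e₀ h).map j.continuous) e _ 1
  refine congrArg (fun c : C(I, E) => c 1) ((cov.eq_liftPath_iff' _).2 ⟨?_, hΓ0⟩)
  funext t
  exact hΓ t

/-- The image of Gottlieb's group consists of the fibre motions at the base point. -/
theorem mem_gottliebImage_iff (hf : IsFibrationWithFibre j f (f (j e₀)))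
    (hp : IsQuotientCoveringMap p G) (φ : FundamentalGroup X (j e₀) →* G) (e : p ⁻¹' {j e₀})
    (he : ∀ γ : FundamentalGroup X (j e₀),
      (hp.isCoveringMap.monodromy γ.toPath e : E) = (φ γ)⁻¹ • (e : E)) (a : G) :
    a ∈ gottliebImage j e₀ φ ↔ IsFibreMotion p f (f (j e₀)) (e : E) a := by
  have cov := hp.isCoveringMap
  constructor
  · intro ha
    -- Passing to a⁻¹, which also lies in the image, compensates for the inverse in the monodromy
    -- convention.
    obtain ⟨w, ⟨h, rfl⟩, hw⟩ := inv_mem ha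
    have h0 : (⟨fun t => j (h (t, e₀)), by fun_prop⟩ : C(I, X)) 0 = p e :=
      (congrArg j (h.apply_zero e₀)).trans e.2.symm
    let Γ : C(I, E) := cov.liftPath ⟨fun t => j (h (t, e₀)), by fun_prop⟩ e h0
    have hΓ0 : Γ 0 = e := cov.liftPath_zero _ _ _
    have hΓ : ∀ t, p (Γ t) = j (h (t, e₀)) := fun t => congrFun (cov.liftPath_lifts _ _ h0) t
    have hΓ1 := monodromy_trackLoop cov φ e he h Γ hΓ0 hΓ
    erw [hw, inv_inv] at hΓ1
    refine ⟨hf.homeomorph e₀, e.2.symm, ⟨fun z => j (h (z.1, hf.homeomorph.symm z.2)), ?_⟩, Γ,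
      fun w => ?_, fun w => ?_, fun z => ?_, hΓ0, hΓ1, fun t => ?_⟩
    · have := hf.homeomorph.symm.continuous
      fun_prop
    · exact (congrArg j (h.apply_zero _)).trans (hf.j_symm w)
    · exact (congrArg j (h.apply_one _)).trans (hf.j_symm w)
    · exact (hf.homeomorph (h (z.1, hf.homeomorph.symm z.2))).2
    · rw [hΓ]
      exact congrArg (fun x => j (h (t, x))) (hf.homeomorph.symm_apply_apply e₀).symm
  · rintro ⟨u, hu, k, Γ, hk0, hk1, hk, hΓ0, hΓ1, hΓ⟩
    let h : ContinuousMap.Homotopy (ContinuousMap.id F) (ContinuousMap.id F) :=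
      { toFun := fun z => hf.homeomorph.symm ⟨k (z.1, hf.homeomorph z.2), hk _⟩
        continuous_toFun := hf.homeomorph.symm.continuous.comp (Continuous.subtype_mk
          (k.continuous.comp (continuous_fst.prodMk
            (hf.homeomorph.continuous.comp continuous_snd))) _)
        map_zero_left := fun x => by simp [hk0]
        map_one_left := fun x => by simp [hk1] }
    have hu' : u = hf.homeomorph e₀ := Subtype.ext (hu.trans e.2)
    have hΓ1' := monodromy_trackLoop cov φ e he h Γ hΓ0 fun t => by
      rw [hΓ, hu']
      exact (hf.j_symm ⟨k (t, hf.homeomorph e₀), hk _⟩).symm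
    have := hp.isCancelSMul
    -- Freeness of the action recovers a from the end point of the lifted track.
    have ha := IsCancelSMul.right_cancel _ _ _ (hΓ1.symm.trans hΓ1')
    rw [ha]
    exact inv_mem ⟨_, ⟨h, rfl⟩, rfl⟩

/-- The total space of the covering associated to an epimorphism is path connected. -/
theorem joined_of_isAssociatedCovering [PathConnectedSpace F] [PathConnectedSpace B]
    (hf : IsFibrationWithFibre j f (f (j e₀))) (LX : PathLifting f)
    (hp : IsQuotientCoveringMap p G) (φ : FundamentalGroup X (j e₀) →* G)
    (hφ : Function.Surjective φ) (e : p ⁻¹' {j e₀})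
    (he : ∀ γ : FundamentalGroup X (j e₀),
      (hp.isCoveringMap.monodromy γ.toPath e : E) = (φ γ)⁻¹ • (e : E)) (y : E) :
    Joined y (e : E) := by
  have cov := hp.isCoveringMap
  have hX : Joined (p y) (j e₀) := by
    let ω : Path (f (p y)) (f (j e₀)) := PathConnectedSpace.somePath _ _
    have h0 : (ω : C(I, B)) 0 = f (p y) := ω.source
    obtain ⟨x, hx⟩ : ∃ x, j x = LX.lift 1 (p y) ω := by
      have : LX.lift 1 (p y) ω ∈ range j := by
        rw [hf.range_eq]
        exact (LX.proj_lift 1 h0).trans ω.target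
      exact this
    have h1 : Joined (p y) (j x) := ⟨⟨⟨fun t => LX.lift t (p y) ω, LX.continuous_lift continuous_id
      continuous_const continuous_const fun _ => h0⟩, LX.lift_zero h0, hx.symm⟩⟩
    exact h1.trans ((PathConnectedSpace.joined x e₀).map j.continuous)
  obtain ⟨δ⟩ := hX
  let Γ := cov.liftPath δ y δ.source
  have hΓ1 : p (Γ 1) = p e :=
    (congrFun (cov.liftPath_lifts _ _ _) 1).trans (δ.target.trans e.2.symm)
  obtain ⟨g, hg⟩ := hp.apply_eq_iff_mem_orbit.1 hΓ1
  have h1 : Joined y (Γ 1) := ⟨⟨Γ, cov.liftPath_zero _ _ _, rfl⟩⟩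
  refine h1.trans (Joined.symm ?_)
  rw [← hg]
  -- Surjectivity of φ realises g⁻¹, so the monodromy along γ joins e to g • e.
  obtain ⟨γ, hγ⟩ := hφ g⁻¹
  have h2 := he γ
  rw [hγ, inv_inv] at h2
  change Joined (e : E) (g • (e : E))
  rw [← h2]
  obtain ⟨c, hc⟩ := Path.Homotopic.Quotient.mk_surjective γ.toPath
  rw [← hc]
  exact ⟨⟨cov.liftPath c e _, cov.liftPath_zero _ _ _, rfl⟩⟩

end Gottlieb

/-! ### Proof of the theorem -/

theorem mainTheorem7
    {F X B E : Type u} [TopologicalSpace F] [TopologicalSpace X] [TopologicalSpace B]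
    [TopologicalSpace E]
    [T2Space F] [CWComplex (univ : Set F)] [ConnectedSpace F]
    [T2Space B] [CWComplex (univ : Set B)] [ConnectedSpace B]
    (j : C(F, X)) (f : C(X, B)) (e₀ : F) (hf : IsFibrationWithFibre j f (f (j e₀)))
    (d : ℕ) (hd : cwDim (univ : Set B) = d)
    {G : Type v} [Group G] (φ : FundamentalGroup X (j e₀) →* G) (hφ : Function.Surjective φ)
    [MulAction G E] [ContinuousConstSMul G E] (p : E → X) (hp : IsAssociatedCovering p φ) :
    (gottliebImage j e₀ φ).Normal ∧
    IsMulCommutative (gottliebImage j e₀ φ) ∧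
    ∀ n : ℕ,
      IsNilpotentModule (subgroupHomologyRep (gottliebImage j e₀ φ) E n) ∧
      filtrationLength (subgroupHomologyRep (gottliebImage j e₀ φ) E n) ≤ d + 1 := by
  obtain ⟨hq, e, he⟩ := hp
  have cov := hq.isCoveringMap
  have hsmul : ∀ (g : G) y, p (g • y) = p y := fun g y => hq.map_smul g
  have := hq.isCancelSMul
  have := cw_locallyPathConnectedSpace (B := F)
  have := cw_locallyPathConnectedSpace (B := B)
  have : PathConnectedSpace F := pathConnectedSpace_iff_connectedSpace.2 inferInstance
  have : PathConnectedSpace B := pathConnectedSpace_iff_connectedSpace.2 inferInstance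
  obtain ⟨LX⟩ := hf.isFibration.nonempty_pathLifting
  obtain ⟨LE, hL⟩ := cov.exists_pathLifting LX
  have hmem := mem_gottliebImage_iff hf hq φ e he
  have hj := joined_of_isAssociatedCovering hf LX hq φ hφ e he
  have heb : f (p e) = f (j e₀) := congrArg f e.2
  -- The fibre of q is a covering of the fibre of f, which is homeomorphic to the complex F.
  have : LocallyConnectedSpace ((fun y => f (p y)) ⁻¹' {f (j e₀)}) := by
    have := hf.homeomorph.symm.locallyConnectedSpace
    exact (cov.restrictPreimage (f ⁻¹' {f (j e₀)})).isLocalHomeomorph.locallyConnectedSpace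
  refine ⟨⟨fun a ha g => ?_⟩, ⟨⟨fun a b => Subtype.ext ?_⟩⟩, fun n => ?_⟩
  · rw [hmem] at ha ⊢
    -- The conjugate is a motion at g • e and is transported back to e.
    exact (ha.smul hsmul g).transport cov hsmul hL heb (hj _).symm
  · have hc := ((hmem a).1 a.2).smul_smul_comm cov hsmul ((hmem b).1 b.2)
    rw [← mul_smul, ← mul_smul] at hc
    exact IsCancelSMul.right_cancel _ _ _ hc
  · refine nilpotent_of_hasNilpotentFiltration (hasNilpotentFiltration_of_kill _ E n (d + 1) ?_)
    have hkill := kill_over_cwSkel cov hsmul hL (gottliebImage j e₀ φ) (b₀ := f (j e₀))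
      (fun a ha => exists_fibre_homotopy_smul cov hsmul fun y hy =>
        ((hmem a).1 ha).transport cov hsmul hL hy (hj y)) n (d + 1)
    rw [cwSkel_eq_univ hd, preimage_univ] at hkill
    exact fun z hz => hkill z (SingChain.inside_univ _ z) hz

end
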